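/- \textbf{Setting.} A decentralized problem consists of a finite set of $n$ nodes, differentiable local functions $f_1,\dots,f_n:\ell_2\to\mathbb R$, and, for every time step $k=0,1,2,\dots$, an undirected loopless graph $\mathcal G_k$ on the nodes with a matrix $W_k\in\mathbb R^{n\times n}$. The global function is $f=\frac1n\sum_{i=1}^n f_i$. A function $h$ is $L$-smooth if $\|\nabla h(y)-\nabla h(x)\|\le L\|y-x\|$ for all $x,y$, and $\mu$-strongly convex if $h(y)\ge h(x)+\langle\nabla h(x),y-x\rangle+\frac\mu2\|y-x\|^2$ for all $x,y$. A \emph{first-order decentralized method} with starting point $x_0\in\ell_2$ maintains on each problem local memories $\mathcal H_i(k)\subseteq\ell_2$ of the nodes $i$ at times $k\ge0$, with $\mathcal H_i(0)=\{x_0\}$. Each time step $k$ is either a local computation, in which $$\mathcal H_i(k+1)\subseteq\operatorname{span}\{x,\nabla f_i(x),\nabla f_i^*(x): x\in\mathcal H_i(k)\}\quad\text{for all } i,$$ where $f_i^*(y)=\sup_x\{\langle y,x\rangle-f_i(x)\}$, or a communication round, in which $$\mathcal H_i(k+1)\subseteq\operatorname{span}\Big(\mathcal H_i(k)\cup\bigcup_{j:\,\{i,j\}\in\mathcal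 E(\mathcal G_k)}\mathcal H_j(k)\Big)\quad\text{for all } i.$$ The method may choose the type of each step and the contents of the memories subject to these inclusions in an arbitrary way, which may depend on the problem; $x_0$ does not depend on the problem. A matrix $W$ is a gossip matrix of a graph $\mathcal G$ if $W_{ij}=0$ whenever $i\ne j$ and $\{i,j\}$ is not an edge, and $\ker W$ is the set of constant vectors. Write $\chi(W)=\lambda_{\max}(W)/\lambda_{\min}^+(W)$ for the ratio of the largest to the smallest positive eigenvalue. \textbf{Theorem.} Let $\chi\ge56$ and $L>16\mu>0$, and let a first-order decentralized method with starting point $x_0$ be given. Then there is a decentralized problem such that (a) every local function $f_i$ is $L$-smooth and $\mu$-strongly convex; (b) for every $k\ge0$, the edge sets of $\mathcal G_k$ and $\mathcal G_{k+1}$ differ in at most two edges (an edge removed or added counts as one); (c) for every $k\ge0$, $W_k$ is the Laplacian of $\mathcal G_k$ for some positive edge weights, is a gossip matrix of $\mathcal G_k$, and has $\chi(W_k)=\chi$; (d) $f$ has a minimizer $x^*\neq x_0$, and for every $k\ge0$, every node $i$ and every vector $x_k\in\mathcal H_i(k)$, $$\|x_k-x^*\|^2\ \ge\ \Big(1-4\sqrt{\mu/L}\Big)^{\frac{72k}{7\chi}+2}\,\|x_0-x^*\|^2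 .$$ -/

import Mathlib

open Set

noncomputable section

/-- The real Hilbert space `ℓ₂` of square-summable sequences. -/
abbrev Ell2 : Type := lp (fun _ : ℕ => ℝ) 2

/-- `h` is `L`-smooth: differentiable, with `L`-Lipschitz gradient. -/
def IsLSmooth (L : ℝ) (h : Ell2 → ℝ) : Prop :=
  Differentiable ℝ h ∧ ∀ x y : Ell2, ‖gradient h y - gradient h x‖ ≤ L * ‖y - x‖

/-- `h` is (differentiable and) `μ`-strongly convex. -/
def IsMuStronglyConvex (μ : ℝ) (h : Ell2 → ℝ) : Prop :=
  Differentiable ℝ h ∧ ∀ x y : Ell2,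
    h x + inner ℝ (gradient h x) (y - x) + μ / 2 * ‖y - x‖ ^ 2 ≤ h y

/-- The Fenchel conjugate `h*(y) = sup_x (⟨y, x⟩ - h x)`; for strongly convex `h` the supremum
is finite. -/
def fenchelConjugate (h : Ell2 → ℝ) (y : Ell2) : ℝ :=
  ⨆ x : Ell2, (inner ℝ y x - h x)

/-- `A` is the weighted adjacency matrix of a weighted graph with underlying graph `G`: it is
symmetric, positive on the edges of `G`, and zero elsewhere (in particular on the diagonal). -/
def IsWeightedAdjacency {n : ℕ} (G : SimpleGraph (Fin n)) (A : Matrix (Fin n) (Fin n) ℝ) : Prop :=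
  A.IsSymm ∧ (∀ i j, G.Adj i j → 0 < A i j) ∧ (∀ i j, ¬ G.Adj i j → A i j = 0)

/-- The Laplacian of the weighted graph with weighted adjacency matrix `A`: the weighted degrees on
the diagonal minus `A`. -/
def weightedLaplacian {n : ℕ} (A : Matrix (Fin n) (Fin n) ℝ) : Matrix (Fin n) (Fin n) ℝ :=
  Matrix.diagonal (fun i => ∑ k, A i k) - A

/-- `W` is the Laplacian of `G` for some choice of positive edge weights. -/
def IsWeightedLaplacianOf {n : ℕ} (G : SimpleGraph (Fin n))
    (W : Matrix (Fin n) (Fin n) ℝ) : Prop :=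
  ∃ A : Matrix (Fin n) (Fin n) ℝ, IsWeightedAdjacency G A ∧ W = weightedLaplacian A

/-- `W` is a gossip matrix of `G`: its off-diagonal entries vanish off the edges of `G`, and its
kernel consists exactly of the constant vectors. -/
def IsGossipMatrix {n : ℕ} (G : SimpleGraph (Fin n)) (W : Matrix (Fin n) (Fin n) ℝ) : Prop :=
  (∀ i j, i ≠ j → ¬ G.Adj i j → W i j = 0) ∧
    ∀ x : Fin n → ℝ, W.mulVec x = 0 ↔ ∀ i j, x i = x j

/-- `χ(W) = χ`: the largest eigenvalue of `W` divided by its smallest positive eigenvalue (both of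
which exist) equals `χ`. -/
def HasConditionNumber {n : ℕ} (W : Matrix (Fin n) (Fin n) ℝ) (χ : ℝ) : Prop :=
  ∃ lmax lmin : ℝ, IsGreatest (spectrum ℝ W) lmax ∧
    IsLeast {t : ℝ | t ∈ spectrum ℝ W ∧ 0 < t} lmin ∧ lmax / lmin = χ

/-- The data of a decentralized optimization problem: `n` nodes, the local function `f i` of each
node `i`, and, for each time step `k`, the communication graph `G k` and a matrix `W k`. -/
structure DecentralizedProblem where
  n : ℕ
  f : Fin n → Ell2 → ℝ
  G : ℕ → SimpleGraph (Fin n)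
  W : ℕ → Matrix (Fin n) (Fin n) ℝ

/-- The global function: the average of the local functions. -/
def DecentralizedProblem.globalFunction (P : DecentralizedProblem) (x : Ell2) : ℝ :=
  (1 / (P.n : ℝ)) * ∑ i, P.f i x

/-- A first-order decentralized method with starting point `x₀`. On a problem `P` it decides which
time steps are communication rounds (`isComm P k`) and which are local computations, and it
determines the local memory `memory P k i` of node `i` at time `k`. The schedule and the choice of
what is stored may depend on the whole problem; the memories are only restricted by the span
conditions. -/
structure FirstOrderMethod where
  x₀ : Ell2
  isComm : DecentralizedProblem → ℕ → Prop
  memory : (P : DecentralizedProblem) → ℕ → Fin P.n → Set Ell2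
  memory_zero : ∀ (P : DecentralizedProblem) (i : Fin P.n), memory P 0 i = {x₀}
  memory_local : ∀ (P : DecentralizedProblem) (k : ℕ), ¬ isComm P k → ∀ i : Fin P.n,
    memory P (k + 1) i ⊆
      Submodule.span ℝ (⋃ x ∈ memory P k i,
        {x, gradient (P.f i) x, gradient (fenchelConjugate (P.f i)) x})
  memory_comm : ∀ (P : DecentralizedProblem) (k : ℕ), isComm P k → ∀ i : Fin P.n,
    memory P (k + 1) i ⊆
      Submodule.span ℝ (⋃ j ∈ {j : Fin P.n | (P.G k).Adj i j ∨ j = i}, memory P k j)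

end

/-! A worst-case quadratic chain is split between two groups of nodes, and the communication graph
changes so that information needs a time proportional to `χ` to pass from one group to the other.

Let `e` be an orthonormal sequence orthogonal to `x₀`. Joining consecutive vectors by the links `e i
- e (i + 1)` gives a chain. The first `v` of the `8 v` nodes hold the odd links, the last `v` hold
the even links, and the middle `6 v` nodes hold only `μ/2 ‖x - x₀‖²`. The average has minimizer `x₀
+ ∑ qⁱ eᵢ` with `q = 1 - 4 √(μ/L)` (`chain_stationary`, `sum_gradient_nodeObjective`). A vector
involving only `x₀` and the first `m` chain vectors has squared distance at least `q ^ (2 m)` times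
the initial one from this minimizer (`norm_sub_geometricVector_ge`).

Links of one parity are disjoint, so a group can extend its known part of the chain by one
coordinate and must then wait for the other group. Conjugate gradients do not help, because the
inverse of `μ + g P` is again a combination of the identity and `P`.

The graph consists of two stars sharing one leaf, the bridge. Whenever the bridge node could have
received the newest coordinate, the bridge moves one place on, and the informed node is left in the
star that already has the information. A crossing, including the final hops, thus takes `6 v + 2`
steps, after which the motion is reversed. The function `level` records this, and
`memory_subset_krylov` shows that it bounds the knowledge of every method.

Each move changes two edges. The bridged stars have weights with Laplacian spectrum in `[1, 3 n]` on
sum-zero vectors (`path_poincare` for the lower end). Increasing one weight then gives condition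
number exactly `χ` by the intermediate value theorem (`exists_weights_conditionNumber_eq`). Hence `v
= ⌊χ / 24⌋` is admissible, and `q ^ (2 (k / (6 v + 2) + 1))` gives the claimed rate. -/

/-! ### Quadratic objectives, their gradients and conjugates. -/

/-- The quadratic function `x ↦ ½⟨A (x - x₀), x - x₀⟩ - ⟨b, x - x₀⟩`. -/
noncomputable def quadraticObjective (A : Ell2 →L[ℝ] Ell2) (b x₀ x : Ell2) : ℝ :=
  inner ℝ (A (x - x₀)) (x - x₀) / 2 - inner ℝ b (x - x₀)

theorem hasGradientAt_quadraticObjective {A : Ell2 →L[ℝ] Ell2}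
    (hA : ∀ x y, inner ℝ (A x) y = inner ℝ x (A y)) (b x₀ x : Ell2) :
    HasGradientAt (quadraticObjective A b x₀) (A (x - x₀) - b) x := by
  rw [hasGradientAt_iff_hasFDerivAt]
  have h1 : HasFDerivAt (fun x : Ell2 => x - x₀) (ContinuousLinearMap.id ℝ Ell2) x :=
    (hasFDerivAt_id x).sub_const x₀
  have h2 : HasFDerivAt (fun x : Ell2 => A (x - x₀)) (A.comp (ContinuousLinearMap.id ℝ Ell2)) x :=
    A.hasFDerivAt.comp x h1
  have h3 := ((h2.inner ℝ h1).mul_const (1 / 2 : ℝ)).sub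
    ((hasFDerivAt_const b x).inner ℝ h1)
  refine (h3.congr_fderiv ?_).congr_of_eventuallyEq (Filter.Eventually.of_forall fun y => ?_)
  · ext v
    have h4 : inner ℝ (A v) (x - x₀) = inner ℝ (A (x - x₀)) v := by
      rw [hA, real_inner_comm]
    simp [inner_sub_left, h4, -map_sub]
    ring
  · simp [quadraticObjective]
    ring

theorem gradient_quadraticObjective {A : Ell2 →L[ℝ] Ell2}
    (hA : ∀ x y, inner ℝ (A x) y = inner ℝ x (A y)) (b x₀ x : Ell2) :
    gradient (quadraticObjective A b x₀) x = A (x - x₀) - b :=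
  (hasGradientAt_quadraticObjective hA b x₀ x).gradient

theorem differentiable_quadraticObjective {A : Ell2 →L[ℝ] Ell2}
    (hA : ∀ x y, inner ℝ (A x) y = inner ℝ x (A y)) (b x₀ : Ell2) :
    Differentiable ℝ (quadraticObjective A b x₀) :=
  fun x => (hasGradientAt_quadraticObjective hA b x₀ x).differentiableAt

theorem isLSmooth_quadraticObjective {A : Ell2 →L[ℝ] Ell2}
    (hA : ∀ x y, inner ℝ (A x) y = inner ℝ x (A y)) {L : ℝ} (hL : ∀ x, ‖A x‖ ≤ L * ‖x‖)
    (b x₀ : Ell2) : IsLSmooth L (quadraticObjective A b x₀) := by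
  refine ⟨differentiable_quadraticObjective hA b x₀, fun x y => ?_⟩
  rw [gradient_quadraticObjective hA, gradient_quadraticObjective hA]
  have h : A (y - x₀) - b - (A (x - x₀) - b) = A (y - x) := by
    rw [map_sub, map_sub, map_sub]; abel
  rw [h]
  exact hL _

theorem isMuStronglyConvex_quadraticObjective {A : Ell2 →L[ℝ] Ell2}
    (hA : ∀ x y, inner ℝ (A x) y = inner ℝ x (A y)) {μ : ℝ}
    (hμ : ∀ x, μ * ‖x‖ ^ 2 ≤ inner ℝ (A x) x) (b x₀ : Ell2) :
    IsMuStronglyConvex μ (quadraticObjective A b x₀) := by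
  refine ⟨differentiable_quadraticObjective hA b x₀, fun x y => ?_⟩
  rw [gradient_quadraticObjective hA]
  obtain ⟨d, rfl⟩ : ∃ d, y = x + d := ⟨y - x, by abel⟩
  have h := hμ d
  have e1 : x + d - x₀ = (x - x₀) + d := by abel
  have h2 : inner ℝ (A d) (x - x₀) = inner ℝ (A (x - x₀)) d := by
    rw [hA, real_inner_comm]
  simp only [quadraticObjective, e1, map_add, add_sub_cancel_left]
  simp only [inner_add_left, inner_add_right, inner_sub_left _ b, h2]
  linarith

theorem fenchelConjugate_quadraticObjective {A R : Ell2 →L[ℝ] Ell2}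
    (hA : ∀ x y, inner ℝ (A x) y = inner ℝ x (A y)) (hpos : ∀ x, 0 ≤ inner ℝ (A x) x)
    (hR : ∀ y, A (R y) = y) (b x₀ y : Ell2) :
    fenchelConjugate (quadraticObjective A b x₀) y =
      quadraticObjective R (-x₀) (-b) y - inner ℝ b x₀ := by
  set z := R (y + b) with hz
  have hAz : A z = y + b := hR _
  -- Completing the square around `x₀ + z`, which is therefore the maximizer.
  have key : ∀ x, inner ℝ y x - quadraticObjective A b x₀ x =
      quadraticObjective R (-x₀) (-b) y - inner ℝ b x₀
        - inner ℝ (A (x - x₀ - z)) (x - x₀ - z) / 2 := by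
    intro x
    obtain ⟨d, rfl⟩ : ∃ d, x = x₀ + d := ⟨x - x₀, by abel⟩
    have h1 : inner ℝ (A d) z = inner ℝ y d + inner ℝ b d := by
      rw [hA, hAz, real_inner_comm, inner_add_left]
    simp only [quadraticObjective, sub_neg_eq_add, ← hz, add_sub_cancel_left, map_sub, hAz]
    simp only [inner_add_left, inner_add_right, inner_sub_left, inner_sub_right, inner_neg_left,
      h1, real_inner_comm y z, real_inner_comm b z, real_inner_comm x₀ y, real_inner_comm x₀ b]
    ring
  rw [fenchelConjugate]
  refine IsLUB.ciSup_eq (IsGreatest.isLUB ⟨⟨x₀ + z, ?_⟩, ?_⟩)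
  · simp only [key]
    simp
  · rintro _ ⟨x, rfl⟩
    simp only [key]
    linarith [hpos (x - x₀ - z)]

theorem gradient_fenchelConjugate_quadraticObjective {A R : Ell2 →L[ℝ] Ell2}
    (hA : ∀ x y, inner ℝ (A x) y = inner ℝ x (A y)) (hpos : ∀ x, 0 ≤ inner ℝ (A x) x)
    (hR : ∀ y, A (R y) = y) (b x₀ y : Ell2) :
    gradient (fenchelConjugate (quadraticObjective A b x₀)) y = R (y + b) + x₀ := by
  have hRs : ∀ x y, inner ℝ (R x) y = inner ℝ x (R y) := fun x y => by
    conv_lhs => rw [← hR y, ← hA, hR]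
  have h := (hasGradientAt_quadraticObjective hRs (-x₀) (-b) y)
  rw [funext (fenchelConjugate_quadraticObjective hA hpos hR b x₀)]
  rw [hasGradientAt_iff_hasFDerivAt] at h
  have h2 := (hasGradientAt_iff_hasFDerivAt.2 (h.sub_const (inner ℝ b x₀))).gradient
  rw [sub_neg_eq_add, sub_neg_eq_add] at h2
  exact h2

/-! ### Operators that are combinations of the identity and a projection. -/

/-- The operator `μ + g P`. -/
noncomputable def shiftedProjection (P : Ell2 →L[ℝ] Ell2) (μ g : ℝ) : Ell2 →L[ℝ] Ell2 :=
  μ • ContinuousLinearMap.id ℝ Ell2 + g • P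

theorem shiftedProjection_apply (P : Ell2 →L[ℝ] Ell2) (μ g : ℝ) (x : Ell2) :
    shiftedProjection P μ g x = μ • x + g • P x := by
  simp [shiftedProjection]

theorem shiftedProjection_symm {P : Ell2 →L[ℝ] Ell2} {μ g : ℝ}
    (hs : ∀ x y, inner ℝ (P x) y = inner ℝ x (P y))
    (x y : Ell2) :
    inner ℝ (shiftedProjection P μ g x) y = inner ℝ x (shiftedProjection P μ g y) := by
  simp [shiftedProjection_apply, inner_add_left, inner_add_right, real_inner_smul_left,
    real_inner_smul_right, hs]

theorem inner_projection_self {P : Ell2 →L[ℝ] Ell2}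
    (hs : ∀ x y, inner ℝ (P x) y = inner ℝ x (P y)) (hi : ∀ x, P (P x) = P x)
    (x : Ell2) : inner ℝ (P x) x = ‖P x‖ ^ 2 := by
  rw [← real_inner_self_eq_norm_sq, ← hs, hi]

theorem norm_projection_le {P : Ell2 →L[ℝ] Ell2}
    (hs : ∀ x y, inner ℝ (P x) y = inner ℝ x (P y)) (hi : ∀ x, P (P x) = P x)
    (x : Ell2) : ‖P x‖ ≤ ‖x‖ := by
  have h1 := inner_projection_self hs hi x
  have h2 := real_inner_le_norm (P x) x
  by_contra! h
  nlinarith [norm_nonneg x, norm_nonneg (P x)]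

theorem norm_shiftedProjection_le {P : Ell2 →L[ℝ] Ell2}
    (hs : ∀ x y, inner ℝ (P x) y = inner ℝ x (P y)) (hi : ∀ x, P (P x) = P x) {μ g : ℝ}
    (hμ : 0 ≤ μ) (hg : 0 ≤ g) (x : Ell2) :
    ‖shiftedProjection P μ g x‖ ≤ (μ + g) * ‖x‖ := by
  rw [shiftedProjection_apply]
  refine (norm_add_le _ _).trans ?_
  rw [norm_smul, norm_smul, Real.norm_of_nonneg hμ, Real.norm_of_nonneg hg]
  nlinarith [norm_projection_le hs hi x]

theorem le_inner_shiftedProjection {P : Ell2 →L[ℝ] Ell2}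
    (hs : ∀ x y, inner ℝ (P x) y = inner ℝ x (P y)) (hi : ∀ x, P (P x) = P x) {μ g : ℝ}
    (hg : 0 ≤ g) (x : Ell2) :
    μ * ‖x‖ ^ 2 ≤ inner ℝ (shiftedProjection P μ g x) x := by
  rw [shiftedProjection_apply, inner_add_left, real_inner_smul_left, real_inner_smul_left,
    inner_projection_self hs hi, real_inner_self_eq_norm_sq]
  nlinarith [mul_nonneg hg (sq_nonneg ‖P x‖)]

/-- On the range of `P` the operator is `μ + g`, on its kernel `μ`. Since the inverse involves no
operator other than `P`, a conjugate gradient reveals no more of the chain than a gradient. -/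
theorem shiftedProjection_inverse {P : Ell2 →L[ℝ] Ell2}
    (hi : ∀ x, P (P x) = P x) {μ g : ℝ} (hμ : 0 < μ) (hg : 0 ≤ g) (y : Ell2) :
    shiftedProjection P μ g (shiftedProjection P μ⁻¹ ((μ + g)⁻¹ - μ⁻¹) y) = y := by
  simp only [shiftedProjection_apply, map_add, map_smul, hi, smul_add, smul_smul]
  have h : μ + g ≠ 0 := by positivity
  match_scalars
  · field_simp
  · field_simp
    ring

/-! ### The chain and its two families of links. -/

/-- Memories may contain arbitrary multiples of `x₀`. Orthogonality ensures that these carry no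
chain coordinate and are killed by the link projections. -/
theorem exists_orthonormal_sequence_orthogonal (x₀ : Ell2) :
    ∃ e : ℕ → Ell2, Orthonormal ℝ e ∧ ∀ i, inner ℝ (e i) x₀ = 0 := by
  set V : Submodule ℝ Ell2 := (ℝ ∙ x₀)ᗮ with hV
  obtain ⟨w, b, hb⟩ := exists_hilbertBasis ℝ V
  have hw : w.Infinite := by
    intro hfin
    have hf : Finite w := hfin
    have hF : Fintype w := Fintype.ofFinite w
    have h1 : FiniteDimensional ℝ V := (b.toOrthonormalBasis.toBasis).finiteDimensional_of_finite
    have h2 : FiniteDimensional ℝ (((ℝ ∙ x₀) ⊔ V : Submodule ℝ Ell2)) := inferInstance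
    rw [hV, Submodule.sup_orthogonal_of_hasOrthogonalProjection] at h2
    have h3 : FiniteDimensional ℝ Ell2 := Module.finite_def.2 (Module.Finite.iff_fg.1 h2)
    have h4 : Orthonormal ℝ (fun i : ℕ => (lp.single 2 i (1 : ℝ) : Ell2)) := by
      rw [orthonormal_iff_ite]
      intro i j
      rw [lp.inner_single_left]
      by_cases h : i = j
      · subst h; simp
      · simp [h]
    exact (h4.linearIndependent.finite).false
  let emb := hw.natEmbedding
  refine ⟨fun i => ((emb i : V) : Ell2), ?_, fun i => ?_⟩
  · have h1 : Orthonormal ℝ (fun i => b (emb i)) := b.orthonormal.comp _ emb.injective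
    rw [hb] at h1
    exact h1.comp_linearIsometry V.subtypeₗᵢ
  · rw [real_inner_comm]
    exact Submodule.mem_orthogonal_singleton_iff_inner_right.1 (emb i : V).2

/-- The orthogonal projection onto the closed span of the differences `e (2k+r) - e (2k+r+1)`. -/
noncomputable def linkProjection (e : ℕ → Ell2) (r : ℕ) : Ell2 →L[ℝ] Ell2 :=
  (Submodule.span ℝ
    (range fun k => e (2 * k + r) - e (2 * k + r + 1))).topologicalClosure.starProjection

theorem linkProjection_symm (e : ℕ → Ell2) (r : ℕ) (x y : Ell2) :
    inner ℝ (linkProjection e r x) y = inner ℝ x (linkProjection e r y) :=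
  Submodule.inner_starProjection_left_eq_right _ x y

theorem linkProjection_idem (e : ℕ → Ell2) (r : ℕ) (x : Ell2) :
    linkProjection e r (linkProjection e r x) = linkProjection e r x :=
  Submodule.starProjection_eq_self_iff.2 (Submodule.starProjection_apply_mem _ _)

/-- Every value needed below is a finite combination of links, so it can be certified by testing the
residual against each link, without expanding the projection as a series. -/
theorem linkProjection_eq {e : ℕ → Ell2} {r : ℕ} {u v : Ell2}
    (hv : v ∈ Submodule.span ℝ (range fun k => e (2 * k + r) - e (2 * k + r + 1)))
    (hz : ∀ k, inner ℝ (e (2 * k + r) - e (2 * k + r + 1)) (u - v) = 0) :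
    linkProjection e r u = v := by
  refine Submodule.eq_starProjection_of_mem_orthogonal
    (Submodule.le_topologicalClosure _ hv) ?_
  rw [Submodule.orthogonal_closure]
  intro y hy
  induction hy using Submodule.span_induction with
  | mem x hx =>
    obtain ⟨k, rfl⟩ := hx
    exact hz k
  | zero => simp
  | add x y _ _ hx hy => rw [inner_add_left, hx, hy, add_zero]
  | smul a x _ hx => rw [real_inner_smul_left, hx, mul_zero]

theorem linkProjection_orthogonal {e : ℕ → Ell2} (r : ℕ) {x₀ : Ell2}
    (h₀ : ∀ i, inner ℝ (e i) x₀ = 0) : linkProjection e r x₀ = 0 :=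
  linkProjection_eq (Submodule.zero_mem _) fun k => by simp [inner_sub_left, h₀]

theorem linkProjection_left {e : ℕ → Ell2} (he : Orthonormal ℝ e) (r k : ℕ) :
    linkProjection e r (e (2 * k + r)) = (1 / 2 : ℝ) • (e (2 * k + r) - e (2 * k + r + 1)) := by
  refine linkProjection_eq (Submodule.smul_mem _ _ (Submodule.subset_span ⟨k, rfl⟩)) fun j => ?_
  rw [orthonormal_iff_ite] at he
  simp only [inner_sub_left, inner_sub_right, real_inner_smul_right, he]
  split_ifs <;> first | omega | norm_num

theorem linkProjection_right {e : ℕ → Ell2} (he : Orthonormal ℝ e) (r k : ℕ) :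
    linkProjection e r (e (2 * k + r + 1)) =
      (1 / 2 : ℝ) • (e (2 * k + r + 1) - e (2 * k + r)) := by
  have h : (1 / 2 : ℝ) • (e (2 * k + r + 1) - e (2 * k + r)) =
      (-(1 / 2) : ℝ) • (e (2 * k + r) - e (2 * k + r + 1)) := by
    rw [neg_smul, ← smul_neg, neg_sub]
  rw [h]
  refine linkProjection_eq (Submodule.smul_mem _ _ (Submodule.subset_span ⟨k, rfl⟩)) fun j => ?_
  rw [orthonormal_iff_ite] at he
  simp only [inner_sub_left, inner_sub_right, real_inner_smul_right, he]
  split_ifs <;> first | omega | norm_num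

theorem linkProjection_one_zero {e : ℕ → Ell2} (he : Orthonormal ℝ e) :
    linkProjection e 1 (e 0) = 0 := by
  refine linkProjection_eq (Submodule.zero_mem _) fun j => ?_
  rw [orthonormal_iff_ite] at he
  simp [inner_sub_left, he]

/-- The two families of links together act as half of the discrete Laplacian. -/
theorem linkProjection_add_zero {e : ℕ → Ell2} (he : Orthonormal ℝ e) :
    linkProjection e 1 (e 0) + linkProjection e 0 (e 0) = (1 / 2 : ℝ) • (e 0 - e 1) := by
  rw [linkProjection_one_zero he, zero_add]
  simpa using linkProjection_left he 0 0

theorem linkProjection_add_succ {e : ℕ → Ell2} (he : Orthonormal ℝ e) (i : ℕ) :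
    linkProjection e 1 (e (i + 1)) + linkProjection e 0 (e (i + 1)) =
      e (i + 1) - (1 / 2 : ℝ) • e i - (1 / 2 : ℝ) • e (i + 2) := by
  obtain ⟨k, rfl | rfl⟩ := Nat.even_or_odd' i
  · have h1 := linkProjection_left he 1 k
    have h2 := linkProjection_right he 0 k
    simp only [add_zero] at h2
    rw [h1, h2]
    module
  · have h1 := linkProjection_right he 1 k
    have h2 := linkProjection_left he 0 (k + 1)
    have e1 : 2 * (k + 1) + 0 = 2 * k + 1 + 1 := by ring
    rw [e1] at h2
    rw [h1, h2]
    module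

/-! ### Growth of the known part of the chain. -/

/-- The span of `x₀` and the first `m` vectors of `e`. -/
noncomputable def krylov (e : ℕ → Ell2) (x₀ : Ell2) (m : ℕ) : Submodule ℝ Ell2 :=
  Submodule.span ℝ (insert x₀ (e '' {i | i < m}))

theorem krylov_mono (e : ℕ → Ell2) (x₀ : Ell2) : Monotone (krylov e x₀) := fun _ _ h =>
  Submodule.span_mono (insert_subset_insert (image_mono fun _ hi => lt_of_lt_of_le hi h))

theorem mem_krylov_start (e : ℕ → Ell2) (x₀ : Ell2) (m : ℕ) : x₀ ∈ krylov e x₀ m :=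
  Submodule.subset_span (mem_insert _ _)

theorem mem_krylov {e : ℕ → Ell2} {x₀ : Ell2} {i m : ℕ} (h : i < m) : e i ∈ krylov e x₀ m :=
  Submodule.subset_span (mem_insert_of_mem _ ⟨i, h, rfl⟩)

theorem inner_krylov {e : ℕ → Ell2} (he : Orthonormal ℝ e) {x₀ : Ell2}
    (h₀ : ∀ i, inner ℝ (e i) x₀ = 0) {m j : ℕ} (hj : m ≤ j) {x : Ell2} (hx : x ∈ krylov e x₀ m) :
    inner ℝ (e j) x = 0 := by
  induction hx using Submodule.span_induction with
  | mem x hx =>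
    rcases hx with rfl | ⟨i, hi, rfl⟩
    · exact h₀ j
    · exact he.2 (by have : i < m := hi; omega)
  | zero => simp
  | add x y _ _ hx hy => rw [inner_add_right, hx, hy, add_zero]
  | smul a x _ hx => rw [real_inner_smul_right, hx, mul_zero]

/-- Links of the family `r` pair `2k + r` with `2k + r + 1`. If `m + r` is even, no such pair
separates the indices below `m` from the others; otherwise only the pair `m - 1, m` can. -/
theorem linkProjection_mem_krylov {e : ℕ → Ell2} (he : Orthonormal ℝ e) {x₀ : Ell2}
    (h₀ : ∀ i, inner ℝ (e i) x₀ = 0) {r m m' : ℕ} (hr : r ≤ 1) (hm : m ≤ m')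
    (h : (m + r) % 2 = 0 ∨ m + 1 ≤ m') {x : Ell2} (hx : x ∈ krylov e x₀ m) :
    linkProjection e r x ∈ krylov e x₀ m' := by
  induction hx using Submodule.span_induction with
  | mem x hx =>
    rcases hx with rfl | ⟨i, hi, rfl⟩
    · rw [linkProjection_orthogonal r h₀]; exact Submodule.zero_mem _
    · have hi : i < m := hi
      by_cases hpar : (i + r) % 2 = 0
      · by_cases hir : r ≤ i
        · obtain ⟨k, rfl⟩ : ∃ k, i = 2 * k + r := ⟨(i - r) / 2, by omega⟩
          rw [linkProjection_left he]
          exact Submodule.smul_mem _ _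
            (Submodule.sub_mem _ (mem_krylov (by omega)) (mem_krylov (by omega)))
        · omega
      · by_cases hir : r + 1 ≤ i
        · obtain ⟨k, rfl⟩ : ∃ k, i = 2 * k + r + 1 := ⟨(i - r - 1) / 2, by omega⟩
          rw [linkProjection_right he]
          exact Submodule.smul_mem _ _
            (Submodule.sub_mem _ (mem_krylov (by omega)) (mem_krylov (by omega)))
        · obtain ⟨rfl, rfl⟩ : r = 1 ∧ i = 0 := by omega
          rw [linkProjection_one_zero he]; exact Submodule.zero_mem _
  | zero => simp
  | add x y _ _ hx hy => rw [map_add]; exact Submodule.add_mem _ hx hy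
  | smul a x _ hx => rw [map_smul]; exact Submodule.smul_mem _ _ hx

/-! ### The geometric minimizer. -/

section geometric

theorem summable_geometric_smul {e : ℕ → Ell2} (he : Orthonormal ℝ e) {q : ℝ} (h0 : 0 ≤ q)
    (h1 : q < 1) : Summable fun i => q ^ i • e i := by
  refine Summable.of_norm ?_
  simpa [norm_smul, he.1, abs_of_nonneg h0] using summable_geometric_of_lt_one h0 h1

/-- The vector `∑ qⁱ eᵢ`. -/
noncomputable def geometricVector (e : ℕ → Ell2) (q : ℝ) : Ell2 := ∑' i, q ^ i • e i

theorem hasSum_geometricVector {e : ℕ → Ell2} (he : Orthonormal ℝ e) {q : ℝ} (h0 : 0 ≤ q)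
    (h1 : q < 1) : HasSum (fun i => q ^ i • e i) (geometricVector e q) :=
  (summable_geometric_smul he h0 h1).hasSum

theorem orthonormal_shift {e : ℕ → Ell2} (he : Orthonormal ℝ e) (m : ℕ) :
    Orthonormal ℝ fun i => e (i + m) :=
  he.comp _ (add_left_injective m)

theorem inner_geometricVector {e : ℕ → Ell2} (he : Orthonormal ℝ e) {q : ℝ} (h0 : 0 ≤ q)
    (h1 : q < 1) (i : ℕ) : inner ℝ (geometricVector e q) (e i) = q ^ i := by
  have h := (hasSum_geometricVector he h0 h1).mapL ((innerSL ℝ (e i)))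
  simp only [innerSL_apply_apply] at h
  rw [real_inner_comm]
  refine h.unique ?_
  rw [orthonormal_iff_ite] at he
  have hfun : (fun j => inner ℝ (e i) (q ^ j • e j)) = fun j => if j = i then q ^ i else 0 := by
    funext j
    rw [real_inner_smul_right, he]
    by_cases hj : j = i
    · simp [hj]
    · simp [hj, Ne.symm hj]
  rw [hfun]
  exact hasSum_ite_eq i (q ^ i)

theorem norm_sq_geometricVector {e : ℕ → Ell2} (he : Orthonormal ℝ e) {q : ℝ} (h0 : 0 ≤ q)
    (h1 : q < 1) : ‖geometricVector e q‖ ^ 2 = (1 - q ^ 2)⁻¹ := by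
  rw [← real_inner_self_eq_norm_sq]
  have h := (hasSum_geometricVector he h0 h1).mapL ((innerSL ℝ (geometricVector e q)))
  simp only [innerSL_apply_apply, real_inner_smul_right, inner_geometricVector he h0 h1] at h
  refine h.unique ?_
  have hq : q ^ 2 < 1 := by nlinarith
  have hfun : (fun i => q ^ i * q ^ i) = fun i => (q ^ 2) ^ i := by
    funext i
    rw [← mul_pow, sq]
  rw [hfun]
  exact hasSum_geometric_of_lt_one (sq_nonneg q) hq

theorem geometricVector_eq_add {e : ℕ → Ell2} (he : Orthonormal ℝ e) {q : ℝ} (h0 : 0 ≤ q)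
    (h1 : q < 1) (m : ℕ) : geometricVector e q =
      ∑ i ∈ Finset.range m, q ^ i • e i + q ^ m • geometricVector (fun i => e (i + m)) q := by
  rw [geometricVector, ← (summable_geometric_smul he h0 h1).sum_add_tsum_nat_add m]
  congr 1
  rw [geometricVector, ← Summable.tsum_const_smul _
    (summable_geometric_smul (orthonormal_shift he m) h0 h1)]
  simp only [smul_smul, ← pow_add, add_comm m]

/-- A vector in the span of `x₀` and the first `m` vectors stays away from `x₀ + ∑ qⁱ eᵢ`. -/
theorem norm_sub_geometricVector_ge {e : ℕ → Ell2} (he : Orthonormal ℝ e) {x₀ : Ell2}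
    (h₀ : ∀ i, inner ℝ (e i) x₀ = 0) {q : ℝ} (h0 : 0 ≤ q) (h1 : q < 1) {m : ℕ} {x : Ell2}
    (hx : x ∈ krylov e x₀ m) :
    q ^ (2 * m) * ‖x₀ - (x₀ + geometricVector e q)‖ ^ 2 ≤
      ‖x - (x₀ + geometricVector e q)‖ ^ 2 := by
  have hs := orthonormal_shift he m
  set z := geometricVector (fun i => e (i + m)) q with hz
  set u := x - x₀ - ∑ i ∈ Finset.range m, q ^ i • e i with hu
  have humem : u ∈ krylov e x₀ m :=
    Submodule.sub_mem _ (Submodule.sub_mem _ hx (mem_krylov_start _ _ _))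
      (Submodule.sum_mem _ fun i hi => Submodule.smul_mem _ _ (mem_krylov (by simpa using hi)))
  have hort : inner ℝ u z = 0 := by
    have h := (hasSum_geometricVector hs h0 h1).mapL ((innerSL ℝ u))
    simp only [innerSL_apply_apply, real_inner_smul_right] at h
    refine h.unique ?_
    have h2 : ∀ i, inner ℝ u (e (i + m)) = 0 := fun i => by
      rw [real_inner_comm]; exact inner_krylov he h₀ (by omega) humem
    simp [h2, hasSum_zero]
  have hxu : x - (x₀ + geometricVector e q) = u - q ^ m • z := by
    rw [geometricVector_eq_add he h0 h1 m, hu]; abel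
  have hn : x₀ - (x₀ + geometricVector e q) = -geometricVector e q := by abel
  -- The tail beyond `m` is `q ^ m` times a shifted copy of the whole vector, of the same norm, and
  -- it is orthogonal to `u`.
  rw [hxu, hn, norm_neg, norm_sq_geometricVector he h0 h1, ← norm_sq_geometricVector hs h0 h1,
    norm_sub_sq_real, real_inner_smul_right, hort, norm_smul, mul_pow, norm_pow,
    Real.norm_of_nonneg h0, ← hz, ← pow_mul, mul_comm m 2]
  nlinarith [sq_nonneg ‖u‖]

/-- `∑ qⁱ eᵢ` solves the stationarity equation of the chain. -/
theorem chain_stationary {e : ℕ → Ell2} (he : Orthonormal ℝ e) {q : ℝ} (h0 : 0 < q)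
    (h1 : q < 1) {μ c : ℝ} (hc : c * (1 - q) ^ 2 = μ * q) :
    μ • geometricVector e q + (2 * c) • (linkProjection e 1 (geometricVector e q) +
      linkProjection e 0 (geometricVector e q)) = (μ + c * (1 - q)) • e 0 := by
  have hs1 := orthonormal_shift he 1
  have hs2 := orthonormal_shift he 2
  set y := geometricVector e q with hy
  set z := geometricVector (fun i => e (i + 1)) q with hz
  set w := geometricVector (fun i => e (i + 2)) q with hw
  have hyz : y = e 0 + q • z := by
    have := geometricVector_eq_add he h0.le h1 1
    simpa using this
  have hzw : z = e 1 + q • w := by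
    have := geometricVector_eq_add hs1 h0.le h1 1
    simpa [add_assoc] using this
  set D := linkProjection e 1 + linkProjection e 0 with hD
  have hDapp : ∀ x, linkProjection e 1 x + linkProjection e 0 x = D x := fun x => rfl
  -- The interior equations hold for all indices at once: `y` and `w` are the copies of `z` shifted
  -- by one in either direction. Only the boundary vector `e 0` needs separate treatment.
  have hDz : D z = z - (1 / 2 : ℝ) • y - (1 / 2 : ℝ) • w := by
    have h := (hasSum_geometricVector hs1 h0.le h1).mapL D
    refine h.unique ?_
    have h2 := ((hasSum_geometricVector hs1 h0.le h1).sub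
      ((hasSum_geometricVector he h0.le h1).const_smul (1 / 2 : ℝ))).sub
      ((hasSum_geometricVector hs2 h0.le h1).const_smul (1 / 2 : ℝ))
    convert h2 using 2 with i
    rw [map_smul, ← hDapp, linkProjection_add_succ he]
    module
  have hDy : D y = (1 / 2 : ℝ) • (e 0 - e 1) + q • D z := by
    conv_lhs => rw [hyz]
    rw [map_add, map_smul, ← hDapp, linkProjection_add_zero he]
  have he1 : e 1 = z - q • w := by rw [hzw]; abel
  have he0 : e 0 = y - q • z := by rw [hyz]; abel
  have key : q • (μ • y + (2 * c) • D y) = q • ((μ + c * (1 - q)) • e 0) := by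
    rw [hDy, hDz, he1, he0]
    match_scalars
    · ring
    · linear_combination (-q) * hc
    · ring
  rw [hDapp]
  exact smul_right_injective _ h0.ne' key

end geometric

/-! ### Spectra of weighted Laplacians. -/

section laplacian

open Matrix

variable {n : ℕ}

theorem weightedLaplacian_mulVec (A : Matrix (Fin n) (Fin n) ℝ) (x : Fin n → ℝ) (i : Fin n) :
    (weightedLaplacian A *ᵥ x) i = ∑ j, A i j * (x i - x j) := by
  simp only [weightedLaplacian, Matrix.sub_mulVec, Pi.sub_apply, Matrix.mulVec_diagonal, mul_sub,
    Finset.sum_sub_distrib, Finset.sum_mul]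
  rfl

theorem weightedLaplacian_isSymm {A : Matrix (Fin n) (Fin n) ℝ} (hA : A.IsSymm) :
    (weightedLaplacian A).IsSymm := by
  rw [weightedLaplacian]
  exact (Matrix.isSymm_diagonal _).sub hA

theorem dotProduct_mulVec_symm {W : Matrix (Fin n) (Fin n) ℝ} (hW : W.IsSymm)
    (x y : Fin n → ℝ) : x ⬝ᵥ (W *ᵥ y) = y ⬝ᵥ (W *ᵥ x) := by
  rw [Matrix.dotProduct_mulVec, ← Matrix.mulVec_transpose, hW, dotProduct_comm]

theorem two_mul_dotProduct_weightedLaplacian {A : Matrix (Fin n) (Fin n) ℝ} (hA : A.IsSymm)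
    (x : Fin n → ℝ) :
    2 * (x ⬝ᵥ (weightedLaplacian A *ᵥ x)) = ∑ i, ∑ j, A i j * (x i - x j) ^ 2 := by
  have h1 : x ⬝ᵥ (weightedLaplacian A *ᵥ x) = ∑ i, ∑ j, A i j * (x i - x j) * x i := by
    simp only [dotProduct, weightedLaplacian_mulVec, Finset.mul_sum]
    exact Finset.sum_congr rfl fun i _ => Finset.sum_congr rfl fun j _ => by ring
  have h2 : x ⬝ᵥ (weightedLaplacian A *ᵥ x) = ∑ i, ∑ j, A i j * (x j - x i) * x j := by
    rw [h1, Finset.sum_comm]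
    exact Finset.sum_congr rfl fun i _ => Finset.sum_congr rfl fun j _ => by rw [hA.apply]
  rw [two_mul]
  nth_rw 1 [h1]
  rw [h2, ← Finset.sum_add_distrib]
  refine Finset.sum_congr rfl fun i _ => ?_
  rw [← Finset.sum_add_distrib]
  exact Finset.sum_congr rfl fun j _ => by ring

theorem sum_weightedLaplacian_mulVec {A : Matrix (Fin n) (Fin n) ℝ} (hA : A.IsSymm)
    (x : Fin n → ℝ) : ∑ i, (weightedLaplacian A *ᵥ x) i = 0 := by
  have h : ∑ i, (weightedLaplacian A *ᵥ x) i = -∑ i, (weightedLaplacian A *ᵥ x) i := by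
    conv_lhs => simp only [weightedLaplacian_mulVec]
    rw [Finset.sum_comm, ← Finset.sum_neg_distrib]
    refine Finset.sum_congr rfl fun i _ => ?_
    rw [weightedLaplacian_mulVec, ← Finset.sum_neg_distrib]
    exact Finset.sum_congr rfl fun j _ => by rw [hA.apply]; ring
  linarith

theorem dotProduct_self_pos {x : Fin n → ℝ} (hx : x ≠ 0) : 0 < x ⬝ᵥ x := by
  refine lt_of_le_of_ne (Finset.sum_nonneg fun i _ => mul_self_nonneg _) fun h => hx ?_
  exact dotProduct_self_eq_zero.1 h.symm

/-- At a minimizer of a nonnegative quadratic form on a subspace, the associated bilinear form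
vanishes. -/
theorem dotProduct_eq_zero_of_minimizer {M : Matrix (Fin n) (Fin n) ℝ} (hM : M.IsSymm)
    {S : Submodule ℝ (Fin n → ℝ)} (h : ∀ y ∈ S, 0 ≤ y ⬝ᵥ (M *ᵥ y)) {x : Fin n → ℝ}
    (hx : x ∈ S) (h0 : x ⬝ᵥ (M *ᵥ x) = 0) {y : Fin n → ℝ} (hy : y ∈ S) :
    y ⬝ᵥ (M *ᵥ x) = 0 := by
  set a := y ⬝ᵥ (M *ᵥ x) with ha
  set b := y ⬝ᵥ (M *ᵥ y) with hb
  have hsym : x ⬝ᵥ (M *ᵥ y) = a := dotProduct_mulVec_symm hM x y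
  have key : ∀ t : ℝ, 0 ≤ 2 * t * a + t ^ 2 * b := by
    intro t
    have := h (x + t • y) (S.add_mem hx (S.smul_mem t hy))
    simp only [Matrix.mulVec_add, Matrix.mulVec_smul, add_dotProduct, dotProduct_add,
      smul_dotProduct, dotProduct_smul, smul_eq_mul, h0, hsym, ← ha, ← hb] at this
    linarith
  have hb0 : 0 ≤ b := h y hy
  -- The denominator `b + 1`, in place of the optimal `b`, also covers `b = 0`.
  have h1 := key (-a / (b + 1))
  have h2 : 2 * (-a / (b + 1)) * a + (-a / (b + 1)) ^ 2 * b = -(a ^ 2 * (b + 2)) / (b + 1) ^ 2 := by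
    field_simp
    ring
  rw [h2, le_div_iff₀ (by positivity)] at h1
  have h3 : a ^ 2 * 2 ≤ 0 := by nlinarith [mul_nonneg (sq_nonneg a) hb0]
  nlinarith [sq_nonneg a]

theorem mem_spectrum_iff_exists_mulVec {W : Matrix (Fin n) (Fin n) ℝ} {t : ℝ} :
    t ∈ spectrum ℝ W ↔ ∃ x : Fin n → ℝ, x ≠ 0 ∧ W *ᵥ x = t • x := by
  rw [← Matrix.spectrum_toLin', ← Module.End.hasEigenvalue_iff_mem_spectrum]
  constructor
  · intro h
    obtain ⟨x, hx⟩ := h.exists_hasEigenvector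
    exact ⟨x, hx.2, by simpa using hx.apply_eq_smul⟩
  · rintro ⟨x, hx, h⟩
    exact Module.End.hasEigenvalue_of_hasEigenvector (x := x)
      ⟨Module.End.mem_eigenspace_iff.2 (by simpa using h), hx⟩

/-- The vectors whose entries sum to zero. -/
def sumZero (n : ℕ) : Submodule ℝ (Fin n → ℝ) where
  carrier := {x | ∑ i, x i = 0}
  add_mem' := by
    intro x y hx hy
    simp only [mem_ofPred_eq, Pi.add_apply, Finset.sum_add_distrib] at *
    rw [hx, hy, add_zero]
  zero_mem' := by simp
  smul_mem' := by
    intro c x hx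
    simp only [mem_ofPred_eq, Pi.smul_apply, smul_eq_mul, ← Finset.mul_sum] at *
    rw [hx, mul_zero]

theorem mem_sumZero {x : Fin n → ℝ} : x ∈ sumZero n ↔ ∑ i, x i = 0 := Iff.rfl

/-- Extremal values of the quadratic form of a Laplacian determine its condition number. -/
theorem hasConditionNumber_of_extremal {A : Matrix (Fin n) (Fin n) ℝ} (hA : A.IsSymm)
    {lmax lmin : ℝ} (hlmin : 0 < lmin)
    (hup : ∀ x, x ⬝ᵥ (weightedLaplacian A *ᵥ x) ≤ lmax * (x ⬝ᵥ x))
    (hlow : ∀ x ∈ sumZero n, lmin * (x ⬝ᵥ x) ≤ x ⬝ᵥ (weightedLaplacian A *ᵥ x))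
    {u : Fin n → ℝ} (hu : u ≠ 0) (hu' : u ⬝ᵥ (weightedLaplacian A *ᵥ u) = lmax * (u ⬝ᵥ u))
    {v : Fin n → ℝ} (hv : v ≠ 0) (hvs : v ∈ sumZero n)
    (hv' : v ⬝ᵥ (weightedLaplacian A *ᵥ v) = lmin * (v ⬝ᵥ v)) :
    HasConditionNumber (weightedLaplacian A) (lmax / lmin) := by
  set W := weightedLaplacian A with hWdef
  have hW : W.IsSymm := weightedLaplacian_isSymm hA
  have h1 : ∀ t : ℝ, (t • (1 : Matrix (Fin n) (Fin n) ℝ)).IsSymm := fun t => by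
    rw [Matrix.IsSymm, Matrix.transpose_smul, Matrix.transpose_one]
  have mv : ∀ (t : ℝ) (x : Fin n → ℝ), (t • (1 : Matrix (Fin n) (Fin n) ℝ)) *ᵥ x = t • x :=
    fun t x => by rw [Matrix.smul_mulVec, Matrix.one_mulVec]
  refine ⟨lmax, lmin, ⟨?_, ?_⟩, ⟨⟨?_, hlmin⟩, ?_⟩, rfl⟩
  · refine mem_spectrum_iff_exists_mulVec.2 ⟨u, hu, ?_⟩
    have hz : (lmax • (1 : Matrix (Fin n) (Fin n) ℝ) - W) *ᵥ u = 0 := by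
      refine dotProduct_self_eq_zero.1 (dotProduct_eq_zero_of_minimizer (S := ⊤)
        ((h1 _).sub hW) (fun y _ => ?_) trivial ?_ trivial)
      · rw [Matrix.sub_mulVec, mv, dotProduct_sub, dotProduct_smul, smul_eq_mul]
        linarith [hup y]
      · rw [Matrix.sub_mulVec, mv, dotProduct_sub, dotProduct_smul, smul_eq_mul]
        linarith
    rw [Matrix.sub_mulVec, mv, sub_eq_zero] at hz
    exact hz.symm
  · intro t ht
    obtain ⟨x, hx, hxt⟩ := mem_spectrum_iff_exists_mulVec.1 ht
    have h := hup x
    rw [hxt, dotProduct_smul, smul_eq_mul] at h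
    exact le_of_mul_le_mul_right h (dotProduct_self_pos hx)
  · refine mem_spectrum_iff_exists_mulVec.2 ⟨v, hv, ?_⟩
    -- The residual lies in the subspace itself, so stationarity may be tested against it and gives
    -- that its square is zero.
    have hmem : (W - lmin • (1 : Matrix (Fin n) (Fin n) ℝ)) *ᵥ v ∈ sumZero n := by
      rw [Matrix.sub_mulVec, mv]
      exact Submodule.sub_mem _ (sum_weightedLaplacian_mulVec hA v) (Submodule.smul_mem _ _ hvs)
    have hz : (W - lmin • (1 : Matrix (Fin n) (Fin n) ℝ)) *ᵥ v = 0 := by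
      refine dotProduct_self_eq_zero.1 (dotProduct_eq_zero_of_minimizer (S := sumZero n)
        (hW.sub (h1 _)) (fun y hy => ?_) hvs ?_ hmem)
      · rw [Matrix.sub_mulVec, mv, dotProduct_sub, dotProduct_smul, smul_eq_mul]
        linarith [hlow y hy]
      · rw [Matrix.sub_mulVec, mv, dotProduct_sub, dotProduct_smul, smul_eq_mul]
        linarith
    rwa [Matrix.sub_mulVec, mv, sub_eq_zero] at hz
  · rintro t ⟨ht, ht0⟩
    obtain ⟨x, hx, hxt⟩ := mem_spectrum_iff_exists_mulVec.1 ht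
    have hxs : x ∈ sumZero n := by
      have h := sum_weightedLaplacian_mulVec hA x
      rw [← hWdef, hxt] at h
      simp only [Pi.smul_apply, smul_eq_mul, ← Finset.mul_sum] at h
      exact (mul_eq_zero.1 h).resolve_left ht0.ne'
    have h := hlow x hxs
    rw [hxt, dotProduct_smul, smul_eq_mul] at h
    exact le_of_mul_le_mul_right h (dotProduct_self_pos hx)

/-- Subtracting the mean from a kernel vector keeps it in the kernel and puts it in `sumZero`, where
the gap forces it to vanish. -/
theorem isGossipMatrix_of_gap {G : SimpleGraph (Fin n)} {A : Matrix (Fin n) (Fin n) ℝ}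
    (hA : IsWeightedAdjacency G A) {l : ℝ} (hl : 0 < l)
    (hlow : ∀ x ∈ sumZero n, l * (x ⬝ᵥ x) ≤ x ⬝ᵥ (weightedLaplacian A *ᵥ x)) :
    IsGossipMatrix G (weightedLaplacian A) := by
  refine ⟨fun i j hij hadj => ?_, fun x => ⟨fun hx => ?_, fun hx => ?_⟩⟩
  · simp [weightedLaplacian, Matrix.diagonal_apply_ne _ hij, hA.2.2 i j hadj]
  · rcases Nat.eq_zero_or_pos n with rfl | hn
    · exact fun i => i.elim0
    set c := (∑ i, x i) / n with hc
    set y : Fin n → ℝ := fun i => x i - c with hy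
    have hys : y ∈ sumZero n := by
      rw [mem_sumZero]
      simp only [hy, Finset.sum_sub_distrib, Finset.sum_const, Finset.card_univ, Fintype.card_fin,
        nsmul_eq_mul, hc]
      field_simp
      ring
    have hWy : weightedLaplacian A *ᵥ y = 0 := by
      rw [← hx]
      funext i
      rw [weightedLaplacian_mulVec, weightedLaplacian_mulVec]
      exact Finset.sum_congr rfl fun j _ => by simp only [hy]; ring
    have h := hlow y hys
    rw [hWy, dotProduct_zero] at h
    have hy0 : y = 0 := by
      by_contra hne
      nlinarith [dotProduct_self_pos hne]
    intro i j
    have hi := congrFun hy0 i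
    have hj := congrFun hy0 j
    simp only [hy, Pi.zero_apply] at hi hj
    linarith
  · funext i
    rw [weightedLaplacian_mulVec]
    exact Finset.sum_eq_zero fun j _ => by rw [hx i j, sub_self, mul_zero]

theorem isCompact_unitSphere (n : ℕ) : IsCompact {x : Fin n → ℝ | x ⬝ᵥ x = 1} := by
  refine (isCompact_Icc (a := fun _ : Fin n => (-1 : ℝ)) (b := fun _ => 1)).of_isClosed_subset
    (isClosed_eq (by unfold dotProduct; fun_prop) continuous_const) fun x hx => ?_
  have h : ∀ i, x i * x i ≤ 1 := fun i => by
    rw [← show x ⬝ᵥ x = 1 from hx]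
    exact Finset.single_le_sum (f := fun i => x i * x i) (fun j _ => mul_self_nonneg _)
      (Finset.mem_univ i)
  exact ⟨fun i => by nlinarith [h i], fun i => by nlinarith [h i]⟩

/-! ### Tuning one weight to reach a prescribed condition number. -/

/-- The weighted adjacency matrix of a single edge of weight one. -/
def edgeMatrix (a b : Fin n) : Matrix (Fin n) (Fin n) ℝ :=
  fun i j => if (i = a ∧ j = b) ∨ (i = b ∧ j = a) then 1 else 0

theorem sum_edgeMatrix {a b : Fin n} (hab : a ≠ b) (x : Fin n → ℝ) :
    ∑ i, ∑ j, edgeMatrix a b i j * (x i - x j) ^ 2 = 2 * (x a - x b) ^ 2 := by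
  have h : ∀ i j, edgeMatrix a b i j * (x i - x j) ^ 2 =
      (if j = b then if i = a then (x i - x j) ^ 2 else 0 else 0) +
      (if j = a then if i = b then (x i - x j) ^ 2 else 0 else 0) := by
    intro i j
    unfold edgeMatrix
    split_ifs <;> simp_all
  simp only [h, Finset.sum_add_distrib]
  simp only [Finset.sum_ite_eq', Finset.mem_univ, if_true]
  ring

/-- If some weights on `G` give a condition number at most `χ`, then raising the weight of one edge
gives condition number exactly `χ`. -/
theorem exists_weights_conditionNumber_eq {G : SimpleGraph (Fin n)}
    {A : Matrix (Fin n) (Fin n) ℝ} (hA : IsWeightedAdjacency G A) {χ : ℝ} (hχ : 0 < χ)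
    (hup : ∀ x, x ⬝ᵥ (weightedLaplacian A *ᵥ x) ≤ χ * (x ⬝ᵥ x))
    (hlow : ∀ x ∈ sumZero n, x ⬝ᵥ x ≤ x ⬝ᵥ (weightedLaplacian A *ᵥ x))
    {a b c d : Fin n} (hab : G.Adj a b) (hcd : c ≠ d) (hac : a ≠ c) (had : a ≠ d) (hbc : b ≠ c)
    (hbd : b ≠ d) :
    ∃ W, IsWeightedLaplacianOf G W ∧ IsGossipMatrix G W ∧ HasConditionNumber W χ := by
  set B : ℝ → Matrix (Fin n) (Fin n) ℝ := fun t => A + t • edgeMatrix a b with hB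
  have hBA : ∀ t, 0 ≤ t → IsWeightedAdjacency G (B t) := by
    intro t ht
    refine ⟨?_, fun i j hij => ?_, fun i j hij => ?_⟩
    · have hE : (edgeMatrix a b).IsSymm := by
        ext i j
        simp only [Matrix.transpose_apply, edgeMatrix]
        congr 1
        rw [eq_iff_iff]
        tauto
      exact hA.1.add (hE.smul t)
    · have h1 := hA.2.1 i j hij
      have h2 : 0 ≤ edgeMatrix a b i j := by unfold edgeMatrix; split_ifs <;> norm_num
      simp only [hB, Matrix.add_apply, Matrix.smul_apply, smul_eq_mul]
      positivity
    · have h2 : edgeMatrix a b i j = 0 := by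
        unfold edgeMatrix
        rw [if_neg]
        rintro (⟨rfl, rfl⟩ | ⟨rfl, rfl⟩)
        · exact hij hab
        · exact hij hab.symm
      simp [hB, hA.2.2 i j hij, h2]
  set F : ℝ → (Fin n → ℝ) → ℝ := fun t x =>
    x ⬝ᵥ (weightedLaplacian A *ᵥ x) + t * (x a - x b) ^ 2 with hF
  have hBF : ∀ t, 0 ≤ t → ∀ x, x ⬝ᵥ (weightedLaplacian (B t) *ᵥ x) = F t x := by
    intro t ht x
    have h1 := two_mul_dotProduct_weightedLaplacian (hBA t ht).1 x
    have h2 := two_mul_dotProduct_weightedLaplacian hA.1 x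
    have h3 := sum_edgeMatrix hab.ne x
    simp only [hB, Matrix.add_apply, Matrix.smul_apply, smul_eq_mul, add_mul,
      Finset.sum_add_distrib, mul_assoc, ← Finset.mul_sum] at h1
    rw [h3, ← h2] at h1
    simp only [hF]
    linarith
  have hFc : Continuous (Function.uncurry F) := by
    simp only [hF, Function.uncurry_def, dotProduct, Matrix.mulVec]
    fun_prop
  set S : Set (Fin n → ℝ) := {x | x ⬝ᵥ x = 1} with hS
  set S0 : Set (Fin n → ℝ) := S ∩ {x | ∑ i, x i = 0} with hS0
  have hSc : IsCompact S := isCompact_unitSphere n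
  have hS0c : IsCompact S0 :=
    hSc.inter_right (isClosed_eq (by fun_prop) continuous_const)
  -- A sum-zero unit vector vanishing at both ends of the edge `a b`. Its energy does not depend on
  -- `t`, so the smallest positive eigenvalue stays bounded while the largest grows.
  set z : Fin n → ℝ := (Real.sqrt 2)⁻¹ • (Pi.single c 1 - Pi.single d 1) with hz
  have hza : z a = 0 := by simp [hz, hac, had]
  have hzb : z b = 0 := by simp [hz, hbc, hbd]
  have hzS0 : z ∈ S0 := by
    constructor
    · have h2 : (Pi.single c 1 - Pi.single d 1 : Fin n → ℝ) ⬝ᵥ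
          (Pi.single c 1 - Pi.single d 1) = 2 := by
        simp [hcd, hcd.symm]
        norm_num
      change z ⬝ᵥ z = 1
      rw [hz, smul_dotProduct, dotProduct_smul, h2, smul_eq_mul, smul_eq_mul, ← mul_assoc,
        ← mul_inv, Real.mul_self_sqrt (by norm_num)]
      norm_num
    · simp [hz, ← Finset.mul_sum]
  have hzS : z ∈ S := hzS0.1
  have hFt : ∀ t, Continuous (F t) := fun t => hFc.comp (by fun_prop : Continuous fun x => (t, x))
  set U : ℝ → ℝ := fun t => sSup (F t '' S) with hU
  set V : ℝ → ℝ := fun t => sInf (F t '' S0) with hV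
  have hUc : Continuous U := hSc.continuous_sSup hFc
  have hVc : Continuous V := hS0c.continuous_sInf hFc
  have hUle : ∀ t, ∀ x ∈ S, F t x ≤ U t := fun t x hx =>
    le_csSup (hSc.image (hFt t)).bddAbove ⟨x, hx, rfl⟩
  have hVle : ∀ t, ∀ x ∈ S0, V t ≤ F t x := fun t x hx =>
    csInf_le (hS0c.image (hFt t)).bddBelow ⟨x, hx, rfl⟩
  have hU0 : U 0 ≤ χ := by
    refine csSup_le ⟨_, z, hzS, rfl⟩ ?_
    rintro _ ⟨x, hx, rfl⟩
    have := hup x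
    rw [show x ⬝ᵥ x = 1 from hx] at this
    simpa [hF] using this
  have hV1 : ∀ t, 0 ≤ t → 1 ≤ V t := by
    intro t ht
    refine le_csInf ⟨_, z, hzS0, rfl⟩ ?_
    rintro _ ⟨x, hx, rfl⟩
    have := hlow x hx.2
    rw [show x ⬝ᵥ x = 1 from hx.1] at this
    have h2 : 0 ≤ t * (x a - x b) ^ 2 := by positivity
    simp only [hF]
    linarith
  set m : ℝ := z ⬝ᵥ (weightedLaplacian A *ᵥ z) with hm
  have hVm : ∀ t, V t ≤ m := by
    intro t
    have := hVle t z hzS0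
    simpa [hF, hza, hzb] using this
  have hm1 : 1 ≤ m := (hV1 0 le_rfl).trans (hVm 0)
  have hUt : ∀ t, 0 ≤ t → t ≤ U t := by
    intro t ht
    have hmem : (Pi.single a 1 : Fin n → ℝ) ∈ S := by simp [hS]
    have h1 := hUle t _ hmem
    have h2 : (0 : ℝ) ≤ (Pi.single a 1 : Fin n → ℝ) ⬝ᵥ
        (weightedLaplacian A *ᵥ (Pi.single a 1 : Fin n → ℝ)) := by
      have h := two_mul_dotProduct_weightedLaplacian hA.1 (Pi.single a 1 : Fin n → ℝ)
      have : 0 ≤ ∑ i, ∑ j, A i j * ((Pi.single a 1 : Fin n → ℝ) i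
          - (Pi.single a 1 : Fin n → ℝ) j) ^ 2 := by
        refine Finset.sum_nonneg fun i _ => Finset.sum_nonneg fun j _ =>
          mul_nonneg ?_ (sq_nonneg _)
        by_cases hij : G.Adj i j
        · exact (hA.2.1 i j hij).le
        · rw [hA.2.2 i j hij]
      linarith
    have h3 : F t (Pi.single a 1) = (Pi.single a 1 : Fin n → ℝ) ⬝ᵥ
        (weightedLaplacian A *ᵥ (Pi.single a 1 : Fin n → ℝ)) + t := by
      simp [hF, hab.ne.symm]
    linarith
  -- At `t = 0` the hypotheses give `U ≤ χ ≤ χ V`. At `t = χ m` they give `U ≥ t = χ m ≥ χ V`.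
  have hivt : ∃ t ∈ Icc 0 (χ * m), U t - χ * V t = 0 := by
    have hcont : ContinuousOn (fun t => U t - χ * V t) (Icc 0 (χ * m)) := by fun_prop
    have h0 : 0 ≤ χ * m := by positivity
    have := intermediate_value_Icc h0 hcont
    refine this ⟨?_, ?_⟩
    · have := hV1 0 le_rfl
      nlinarith
    · have h1 := hUt (χ * m) h0
      have h2 := hVm (χ * m)
      have h3 : χ * V (χ * m) ≤ χ * m := by gcongr
      linarith
  obtain ⟨t, ⟨ht, -⟩, hUV⟩ := hivt
  have hVt : 0 < V t := lt_of_lt_of_le one_pos (hV1 t ht)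
  obtain ⟨u, huS, hu⟩ : ∃ u ∈ S, F t u = U t :=
    (hSc.image (hFt t)).sSup_mem ⟨_, z, hzS, rfl⟩
  obtain ⟨v, hvS, hv⟩ : ∃ v ∈ S0, F t v = V t :=
    (hS0c.image (hFt t)).sInf_mem ⟨_, z, hzS0, rfl⟩
  have hne : ∀ x ∈ S, x ≠ 0 := by
    rintro x hx rfl
    have h : (0 : Fin n → ℝ) ⬝ᵥ 0 = 1 := hx
    simp at h
  -- Quadratic homogeneity transfers the extremal bounds from the unit sphere to all vectors.
  have hscale : ∀ x : Fin n → ℝ, x ≠ 0 → ∃ s : ℝ, ∃ y ∈ S, x = s • y ∧ x ⬝ᵥ x = s ^ 2 ∧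
      F t x = s ^ 2 * F t y ∧ (x ∈ sumZero n → y ∈ S0) := by
    intro x hx
    have hpos := dotProduct_self_pos hx
    have hsq := Real.sq_sqrt hpos.le
    have hs0 : Real.sqrt (x ⬝ᵥ x) ≠ 0 := (Real.sqrt_pos.2 hpos).ne'
    have hyS : (Real.sqrt (x ⬝ᵥ x))⁻¹ • x ∈ S := by
      simp only [hS, mem_ofPred_eq, smul_dotProduct, dotProduct_smul, smul_eq_mul]
      field_simp
      exact hsq.symm
    have hxy : x = Real.sqrt (x ⬝ᵥ x) • ((Real.sqrt (x ⬝ᵥ x))⁻¹ • x) := by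
      rw [smul_smul, mul_inv_cancel₀ hs0, one_smul]
    refine ⟨Real.sqrt (x ⬝ᵥ x), _, hyS, hxy, hsq.symm, ?_, fun h => ⟨hyS, ?_⟩⟩
    · conv_lhs => rw [hxy]
      simp only [hF, Matrix.mulVec_smul, smul_dotProduct, dotProduct_smul, smul_eq_mul,
        Pi.smul_apply]
      ring
    · exact (sumZero n).smul_mem _ h
  have hlow' : ∀ x ∈ sumZero n, V t * (x ⬝ᵥ x) ≤ x ⬝ᵥ (weightedLaplacian (B t) *ᵥ x) := by
    intro x hx
    rw [hBF t ht]
    by_cases hx0 : x = 0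
    · simp [hx0, hF]
    · obtain ⟨s, y, hyS, -, h1, h2, h3⟩ := hscale x hx0
      rw [h1, h2, mul_comm]
      exact mul_le_mul_of_nonneg_left (hVle t y (h3 hx)) (sq_nonneg s)
  refine ⟨weightedLaplacian (B t), ⟨B t, hBA t ht, rfl⟩,
    isGossipMatrix_of_gap (hBA t ht) hVt hlow', ?_⟩
  have hχeq : χ = U t / V t := by
    rw [eq_div_iff hVt.ne']
    linarith
  rw [hχeq]
  refine hasConditionNumber_of_extremal (hBA t ht).1 hVt (fun x => ?_) hlow'
    (hne u huS) ?_ (hne v hvS.1) hvS.2 ?_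
  · rw [hBF t ht]
    by_cases hx0 : x = 0
    · simp [hx0, hF]
    · obtain ⟨s, y, hyS, -, h1, h2, -⟩ := hscale x hx0
      rw [h1, h2, mul_comm (U t)]
      exact mul_le_mul_of_nonneg_left (hUle t y hyS) (sq_nonneg s)
  · rw [hBF t ht, hu, show u ⬝ᵥ u = 1 from huS, mul_one]
  · rw [hBF t ht, hv, show v ⬝ᵥ v = 1 from hvS.1, mul_one]

end laplacian

/-! ### The bridged stars and their weights. -/

section bridgedStars

open Matrix

/-- Two stars with centres `0` and `n - 1`, joined through the common neighbour `p`: the first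
centre is adjacent to `1, …, p` and the second one to `p, …, n - 2`. -/
def bridgedStars (n p : ℕ) : SimpleGraph (Fin n) where
  Adj i j := ((i : ℕ) = 0 ∧ 0 < (j : ℕ) ∧ (j : ℕ) ≤ p) ∨ ((j : ℕ) = 0 ∧ 0 < (i : ℕ) ∧ (i : ℕ) ≤ p) ∨
    (i ≠ j ∧ (i : ℕ) + 1 = n ∧ p ≤ (j : ℕ)) ∨ (i ≠ j ∧ (j : ℕ) + 1 = n ∧ p ≤ (i : ℕ))
  symm := ⟨fun i j h => by
    rcases h with h | h | h | h
    · exact Or.inr (Or.inl h)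
    · exact Or.inl h
    · exact Or.inr (Or.inr (Or.inr ⟨h.1.symm, h.2⟩))
    · exact Or.inr (Or.inr (Or.inl ⟨h.1.symm, h.2⟩))⟩
  loopless := ⟨fun i h => by
    rcases h with h | h | h | h
    · omega
    · omega
    · exact h.1 rfl
    · exact h.1 rfl⟩

variable {n : ℕ}

/-- Weights of a star with centre `a` and edge weights `l`. -/
def starMatrix (a : Fin n) (l : Fin n → ℝ) : Matrix (Fin n) (Fin n) ℝ :=
  fun i j => (if i = a then l j else 0) + (if j = a then l i else 0)

theorem starMatrix_isSymm (a : Fin n) (l : Fin n → ℝ) : (starMatrix a l).IsSymm := by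
  ext i j
  simp only [Matrix.transpose_apply, starMatrix]
  ring

theorem sum_starMatrix (a : Fin n) (l x : Fin n → ℝ) :
    ∑ i, ∑ j, starMatrix a l i j * (x i - x j) ^ 2 = 2 * ∑ j, l j * (x a - x j) ^ 2 := by
  simp only [starMatrix, add_mul, Finset.sum_add_distrib, ite_mul, zero_mul]
  rw [Finset.sum_comm]
  simp only [Finset.sum_ite_eq', Finset.mem_univ, if_true]
  rw [two_mul]
  congr 1
  exact Finset.sum_congr rfl fun j _ => by ring

/-- The edge weights of the first star. -/
noncomputable def leftWeight (p : Fin n) (α w : ℝ) (j : Fin n) : ℝ :=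
  if j = p then w else if 0 < (j : ℕ) ∧ j < p then α else 0

/-- The edge weights of the second star. -/
noncomputable def rightWeight (p : Fin n) (β w : ℝ) (j : Fin n) : ℝ :=
  if j = p then w else if p < j ∧ (j : ℕ) + 1 < n then β else 0

/-- The weighted adjacency matrix of the bridged stars. -/
noncomputable def bridgedStarsMatrix (a p c : Fin n) (α β w : ℝ) : Matrix (Fin n) (Fin n) ℝ :=
  starMatrix a (leftWeight p α w) + starMatrix c (rightWeight p β w)

theorem isWeightedAdjacency_bridgedStarsMatrix {a p c : Fin n} (ha : (a : ℕ) = 0)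
    (hc : (c : ℕ) + 1 = n) (hap : a < p) (hpc : p < c) {α β w : ℝ} (hα : 0 < α) (hβ : 0 < β)
    (hw : 0 < w) : IsWeightedAdjacency (bridgedStars n p) (bridgedStarsMatrix a p c α β w) := by
  have hi : ∀ i : Fin n, i = a ↔ (i : ℕ) = 0 := fun i => by rw [Fin.ext_iff, ha]
  have hic : ∀ i : Fin n, i = c ↔ (i : ℕ) + 1 = n := fun i => by rw [Fin.ext_iff]; omega
  rw [Fin.lt_def] at hap hpc
  refine ⟨(starMatrix_isSymm _ _).add (starMatrix_isSymm _ _), fun i j hij => ?_,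
    fun i j hij => ?_⟩
  · have hl : ∀ j, 0 ≤ leftWeight p α w j := fun j => by
      unfold leftWeight; split_ifs <;> linarith
    have hr : ∀ j, 0 ≤ rightWeight p β w j := fun j => by
      unfold rightWeight; split_ifs <;> linarith
    have hl' : ∀ j : Fin n, 0 < (j : ℕ) → (j : ℕ) ≤ p → 0 < leftWeight p α w j := by
      intro j h1 h2
      unfold leftWeight
      split_ifs with h3 h4
      · exact hw
      · exact hα
      · rw [Fin.ext_iff] at h3
        rw [Fin.lt_def] at h4
        omega
    have hr' : ∀ j : Fin n, (j : ℕ) + 1 ≠ n → p ≤ (j : ℕ) → 0 < rightWeight p β w j := by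
      intro j h1 h2
      unfold rightWeight
      split_ifs with h3 h4
      · exact hw
      · exact hβ
      · rw [Fin.ext_iff] at h3
        rw [Fin.lt_def] at h4
        omega
    have hs : ∀ (a i j : Fin n) (l : Fin n → ℝ), (∀ j, 0 ≤ l j) → 0 ≤ starMatrix a l i j := by
      intro a i j l h
      unfold starMatrix
      split_ifs <;> linarith [h i, h j]
    have h1 := hs a i j _ hl
    have h2 := hs c i j _ hr
    rw [bridgedStarsMatrix, Matrix.add_apply]
    rcases hij with h | h | h | h
    · have : 0 < starMatrix a (leftWeight p α w) i j := by
        rw [starMatrix, if_pos ((hi i).2 h.1)]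
        have := hl' j h.2.1 h.2.2
        split_ifs <;> linarith [hl i]
      linarith
    · have : 0 < starMatrix a (leftWeight p α w) i j := by
        rw [starMatrix, if_pos ((hi j).2 h.1)]
        have := hl' i h.2.1 h.2.2
        split_ifs <;> linarith [hl j]
      linarith
    · have : 0 < starMatrix c (rightWeight p β w) i j := by
        rw [starMatrix, if_pos ((hic i).2 h.2.1)]
        have := hr' j (fun hj => h.1 (Fin.ext (by omega))) h.2.2
        split_ifs <;> linarith [hr i]
      linarith
    · have : 0 < starMatrix c (rightWeight p β w) i j := by
        rw [starMatrix, if_pos ((hic j).2 h.2.1)]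
        have := hr' i (fun hj => h.1 (Fin.ext (by omega))) h.2.2
        split_ifs <;> linarith [hr j]
      linarith
  · have hl : ∀ i j : Fin n, ¬ (bridgedStars n p).Adj i j → i = a → leftWeight p α w j = 0 := by
      intro i j hij h
      have h0 := (hi i).1 h
      unfold leftWeight
      rw [if_neg, if_neg]
      · rintro ⟨h1, h2⟩
        exact hij (Or.inl ⟨h0, h1, (Fin.lt_def.1 h2).le⟩)
      · rintro rfl
        exact hij (Or.inl ⟨h0, by omega, le_rfl⟩)
    have hr : ∀ i j : Fin n, ¬ (bridgedStars n p).Adj i j → i = c → rightWeight p β w j = 0 := by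
      intro i j hij h
      have h0 := (hic i).1 h
      unfold rightWeight
      rw [if_neg, if_neg]
      · rintro ⟨h1, h2⟩
        refine hij (Or.inr (Or.inr (Or.inl ⟨?_, h0, (Fin.lt_def.1 h1).le⟩)))
        rintro rfl
        omega
      · rintro rfl
        refine hij (Or.inr (Or.inr (Or.inl ⟨?_, h0, le_rfl⟩)))
        rintro rfl
        omega
    have hji : ¬ (bridgedStars n p).Adj j i := fun h => hij h.symm
    have el : ∀ i j : Fin n, ¬ (bridgedStars n p).Adj i j →
        (if i = a then leftWeight p α w j else 0) = 0 := fun i j h => by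
      split_ifs with hia
      · exact hl i j h hia
      · rfl
    have er : ∀ i j : Fin n, ¬ (bridgedStars n p).Adj i j →
        (if i = c then rightWeight p β w j else 0) = 0 := fun i j h => by
      split_ifs with hia
      · exact hr i j h hia
      · rfl
    rw [bridgedStarsMatrix, Matrix.add_apply, starMatrix, starMatrix, el i j hij, el j i hji,
      er i j hij, er j i hji]
    norm_num

theorem sum_eq_split {a p c : Fin n} (ha : (a : ℕ) = 0) (hc : (c : ℕ) + 1 = n) (hap : a < p)
    (hpc : p < c) (f : Fin n → ℝ) :
    ∑ j, f j = f a + f p + f c + ∑ j ∈ Finset.Ioo a p, f j + ∑ j ∈ Finset.Ioo p c, f j := by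
  have hu : (Finset.univ : Finset (Fin n)) =
      insert a (insert p (insert c (Finset.Ioo a p ∪ Finset.Ioo p c))) := by
    ext j
    simp only [Finset.mem_univ, Finset.mem_insert, Finset.mem_union, Finset.mem_Ioo, true_iff,
      Fin.ext_iff, Fin.lt_def]
    omega
  rw [Fin.lt_def] at hap hpc
  have hd : Disjoint (Finset.Ioo a p) (Finset.Ioo p c) := by
    rw [Finset.disjoint_left]
    intro j h1 h2
    rw [Finset.mem_Ioo] at h1 h2
    exact lt_asymm h1.2 h2.1
  rw [hu, Finset.sum_insert, Finset.sum_insert, Finset.sum_insert, Finset.sum_union hd]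
  · ring
  all_goals
    simp only [Finset.mem_insert, Finset.mem_union, Finset.mem_Ioo, Fin.ext_iff, Fin.lt_def]
    omega

theorem dotProduct_bridgedStars {a p c : Fin n} (ha : (a : ℕ) = 0) (hc : (c : ℕ) + 1 = n)
    (hap : a < p) (hpc : p < c) (α β w : ℝ) (x : Fin n → ℝ) :
    x ⬝ᵥ (weightedLaplacian (bridgedStarsMatrix a p c α β w) *ᵥ x) =
      α * ∑ j ∈ Finset.Ioo a p, (x j - x a) ^ 2 + w * (x a - x p) ^ 2 + w * (x p - x c) ^ 2 +
        β * ∑ j ∈ Finset.Ioo p c, (x j - x c) ^ 2 := by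
  have h := two_mul_dotProduct_weightedLaplacian
    ((starMatrix_isSymm a (leftWeight p α w)).add (starMatrix_isSymm c (rightWeight p β w))) x
  simp only [Matrix.add_apply, add_mul, Finset.sum_add_distrib] at h
  rw [sum_starMatrix, sum_starMatrix, sum_eq_split ha hc hap hpc, sum_eq_split ha hc hap hpc] at h
  have hl : ∑ j ∈ Finset.Ioo a p, leftWeight p α w j * (x a - x j) ^ 2 =
      α * ∑ j ∈ Finset.Ioo a p, (x j - x a) ^ 2 := by
    rw [Finset.mul_sum]
    refine Finset.sum_congr rfl fun j hj => ?_
    rw [Finset.mem_Ioo, Fin.lt_def] at hj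
    rw [leftWeight, if_neg hj.2.ne, if_pos ⟨by omega, hj.2⟩]
    ring
  have hl0 : ∑ j ∈ Finset.Ioo p c, leftWeight p α w j * (x a - x j) ^ 2 = 0 := by
    refine Finset.sum_eq_zero fun j hj => ?_
    rw [Finset.mem_Ioo] at hj
    rw [leftWeight, if_neg hj.1.ne', if_neg fun h => lt_asymm h.2 hj.1, zero_mul]
  have hr : ∑ j ∈ Finset.Ioo p c, rightWeight p β w j * (x c - x j) ^ 2 =
      β * ∑ j ∈ Finset.Ioo p c, (x j - x c) ^ 2 := by
    rw [Finset.mul_sum]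
    refine Finset.sum_congr rfl fun j hj => ?_
    rw [Finset.mem_Ioo, Fin.lt_def (a := j) (b := c)] at hj
    rw [rightWeight, if_neg hj.1.ne', if_pos ⟨hj.1, by omega⟩]
    ring
  have hr0 : ∑ j ∈ Finset.Ioo a p, rightWeight p β w j * (x c - x j) ^ 2 = 0 := by
    refine Finset.sum_eq_zero fun j hj => ?_
    rw [Finset.mem_Ioo] at hj
    rw [rightWeight, if_neg hj.2.ne, if_neg fun h => lt_asymm h.1 hj.2, zero_mul]
  have h1 : leftWeight p α w p = w := if_pos rfl
  have h2 : rightWeight p β w p = w := if_pos rfl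
  have h3 : leftWeight p α w c = 0 := by
    rw [leftWeight, if_neg hpc.ne', if_neg fun h => lt_asymm h.2 hpc]
  have h4 : rightWeight p β w a = 0 := by
    rw [rightWeight, if_neg hap.ne, if_neg fun h => lt_asymm h.1 hap]
  rw [hl, hl0, hr, hr0, h1, h2, h3, h4] at h
  rw [bridgedStarsMatrix]
  linarith

/-- The weighted Poincaré inequality on a path of five points with masses `s, 1, 1, 1, t`. -/
theorem path_poincare {n s t : ℝ} (hs : 0 < s) (ht : 0 < t) (hn : s + t + 3 = n)
    {d₁ a b c d₄ : ℝ} (h0 : a + b + c + s * (a + d₁) + t * (c + d₄) = 0) :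
    a ^ 2 + b ^ 2 + c ^ 2 + s * (a + d₁) ^ 2 + t * (c + d₄) ^ 2 ≤
      3 * n / (2 * s + 1) * s * d₁ ^ 2 + 3 * n / 4 * (a - b) ^ 2 + 3 * n / 4 * (b - c) ^ 2 +
        3 * n / (2 * t + 1) * t * d₄ ^ 2 := by
  have hn0 : 0 < n := by linarith
  obtain ⟨d₂, hd₂⟩ : ∃ d, d = a - b := ⟨_, rfl⟩
  obtain ⟨d₃, hd₃⟩ : ∃ d, d = b - c := ⟨_, rfl⟩
  -- These are weighted Cauchy–Schwarz inequalities `(∑ dᵢ)² ≤ ∑ dᵢ² / θᵢ` with `∑ θᵢ = 1`, where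
  -- the leaf steps `d₁`, `d₄` get half the share `θ` of the bridge steps `d₂`, `d₃`.
  have e1 : (d₁ + d₂ + d₃ - d₄) ^ 2 ≤ 6 * d₁ ^ 2 + 3 * d₂ ^ 2 + 3 * d₃ ^ 2 + 6 * d₄ ^ 2 := by
    linarith [sq_nonneg (2 * d₁ - d₂), sq_nonneg (2 * d₁ - d₃), sq_nonneg (d₁ + d₄),
      sq_nonneg (d₂ - d₃), sq_nonneg (d₂ + 2 * d₄), sq_nonneg (d₃ + 2 * d₄)]
  have e2 : (d₁ + d₂) ^ 2 ≤ 3 * d₁ ^ 2 + 3 / 2 * d₂ ^ 2 := by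
    linarith [sq_nonneg (2 * d₁ - d₂)]
  have e3 : (d₁ + d₂ + d₃) ^ 2 ≤ 5 * d₁ ^ 2 + 5 / 2 * d₂ ^ 2 + 5 / 2 * d₃ ^ 2 := by
    linarith [sq_nonneg (2 * d₁ - d₂), sq_nonneg (2 * d₁ - d₃), sq_nonneg (d₂ - d₃)]
  have e4 : (d₃ - d₄) ^ 2 ≤ 3 / 2 * d₃ ^ 2 + 3 * d₄ ^ 2 := by
    linarith [sq_nonneg (2 * d₄ + d₃)]
  have e5 : (d₂ + d₃ - d₄) ^ 2 ≤ 5 / 2 * d₂ ^ 2 + 5 / 2 * d₃ ^ 2 + 5 * d₄ ^ 2 := by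
    linarith [sq_nonneg (2 * d₄ + d₂), sq_nonneg (2 * d₄ + d₃), sq_nonneg (d₂ - d₃)]
  have e6 : (d₂ + d₃) ^ 2 ≤ 2 * d₂ ^ 2 + 2 * d₃ ^ 2 := by
    linarith [sq_nonneg (d₂ - d₃)]
  -- Lagrange's identity: for weighted mean zero, total mass times the weighted sum of squares is
  -- the sum of `mᵢ mⱼ (xᵢ - xⱼ)²` over pairs.
  have lag : n * (a ^ 2 + b ^ 2 + c ^ 2 + s * (a + d₁) ^ 2 + t * (c + d₄) ^ 2) =
      s * t * (d₁ + d₂ + d₃ - d₄) ^ 2 + s * (d₁ ^ 2 + (d₁ + d₂) ^ 2 + (d₁ + d₂ + d₃) ^ 2) +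
      t * (d₄ ^ 2 + (d₃ - d₄) ^ 2 + (d₂ + d₃ - d₄) ^ 2) + d₂ ^ 2 + d₃ ^ 2 + (d₂ + d₃) ^ 2 := by
    rw [hd₂, hd₃, ← hn]
    linear_combination (a + b + c + s * (a + d₁) + t * (c + d₄)) * h0
  have hst := mul_pos hs ht
  have f1 := mul_le_mul_of_nonneg_left e1 hst.le
  have f2 := mul_le_mul_of_nonneg_left (add_le_add (add_le_add (le_refl (d₁ ^ 2)) e2) e3) hs.le
  have f3 := mul_le_mul_of_nonneg_left (add_le_add (add_le_add (le_refl (d₄ ^ 2)) e4) e5) ht.le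
  -- The coefficient of each squared step is compared with its weight; after clearing denominators,
  -- `4 s t ≤ (s + t)²` suffices in each case.
  have c1 : 6 * (s * t) + 9 * s ≤ n * (3 * n / (2 * s + 1) * s) := by
    have h : n * (3 * n / (2 * s + 1) * s) = 3 * n ^ 2 * s / (2 * s + 1) := by ring
    rw [h, le_div_iff₀ (by positivity)]
    subst hn
    linarith [mul_nonneg hs.le (sq_nonneg (s - t))]
  have c4 : 6 * (s * t) + 9 * t ≤ n * (3 * n / (2 * t + 1) * t) := by
    have h : n * (3 * n / (2 * t + 1) * t) = 3 * n ^ 2 * t / (2 * t + 1) := by ring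
    rw [h, le_div_iff₀ (by positivity)]
    subst hn
    linarith [mul_nonneg ht.le (sq_nonneg (s - t))]
  have c2 : 3 * (s * t) + 4 * s + 5 / 2 * t + 3 ≤ n * (3 * n / 4) := by
    subst hn
    linarith [sq_nonneg (s - t)]
  have c3 : 3 * (s * t) + 5 / 2 * s + 4 * t + 3 ≤ n * (3 * n / 4) := by
    subst hn
    linarith [sq_nonneg (s - t)]
  have g1 := mul_le_mul_of_nonneg_right c1 (sq_nonneg d₁)
  have g2 := mul_le_mul_of_nonneg_right c2 (sq_nonneg d₂)
  have g3 := mul_le_mul_of_nonneg_right c3 (sq_nonneg d₃)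
  have g4 := mul_le_mul_of_nonneg_right c4 (sq_nonneg d₄)
  refine le_of_mul_le_mul_left ?_ hn0
  rw [lag, ← hd₂, ← hd₃]
  generalize 3 * n / (2 * s + 1) * s = A at *
  generalize 3 * n / (2 * t + 1) * t = B at *
  clear lag e1 e2 e3 e4 e5 c1 c2 c3 c4 h0
  linarith

/-- With `a + d` the mean over `S`, the variance around it enters both sides, and `α ≥ 1` makes the
right side win. This collapses the leaves of a star to one point of mass `S.card`. -/
theorem sum_sub_sq_ge {ι : Type*} (S : Finset ι) (x : ι → ℝ) (a : ℝ) (hS : 0 < S.card) {α : ℝ}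
    (hα : 1 ≤ α) : ∃ d : ℝ, ∑ j ∈ S, x j = S.card * (a + d) ∧
      ∑ j ∈ S, x j ^ 2 - S.card * (a + d) ^ 2 ≤
        α * ∑ j ∈ S, (x j - a) ^ 2 - α * S.card * d ^ 2 := by
  have hs : (0 : ℝ) < S.card := by exact_mod_cast hS
  obtain ⟨s, hsd⟩ : ∃ s : ℝ, s = S.card := ⟨_, rfl⟩
  rw [← hsd] at hs ⊢
  refine ⟨(∑ j ∈ S, x j) / s - a, by field_simp; ring, ?_⟩
  set m := (∑ j ∈ S, x j) / s with hm
  have hsum : ∑ j ∈ S, x j = s * m := by rw [hm]; field_simp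
  have h1 : ∀ z : ℝ, ∑ j ∈ S, (x j - z) ^ 2 = ∑ j ∈ S, x j ^ 2 - 2 * z * (s * m) + s * z ^ 2 := by
    intro z
    have h : ∀ j ∈ S, (x j - z) ^ 2 = x j ^ 2 - 2 * z * x j + z ^ 2 := fun j _ => by ring
    rw [Finset.sum_congr rfl h, Finset.sum_add_distrib, Finset.sum_sub_distrib,
      ← Finset.mul_sum, hsum, Finset.sum_const, nsmul_eq_mul, ← hsd]
  have h2 : 0 ≤ ∑ j ∈ S, (x j - m) ^ 2 := Finset.sum_nonneg fun j _ => sq_nonneg _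
  rw [h1] at h2 ⊢
  nlinarith [mul_le_mul_of_nonneg_right hα h2]

theorem card_Ioo_fin {a p : Fin n} (h : a < p) :
    ((Finset.Ioo a p).card : ℝ) = (p : ℕ) - (a : ℕ) - 1 := by
  rw [Fin.lt_def] at h
  rw [Fin.card_Ioo, Nat.cast_sub (by omega), Nat.cast_sub (by omega), Nat.cast_one]

/-- For every position of the bridge, the weights of the bridged stars can be chosen with any
prescribed condition number `χ ≥ 3 n`. -/
theorem exists_weights_bridgedStars {p : ℕ} (h2 : 2 ≤ p) (hp : p + 3 ≤ n) {χ : ℝ}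
    (hχ : 3 * (n : ℝ) ≤ χ) :
    ∃ W, IsWeightedLaplacianOf (bridgedStars n p) W ∧ IsGossipMatrix (bridgedStars n p) W ∧
      HasConditionNumber W χ := by
  obtain ⟨a, ha⟩ : ∃ a : Fin n, (a : ℕ) = 0 := ⟨⟨0, by omega⟩, rfl⟩
  obtain ⟨c, hc⟩ : ∃ c : Fin n, (c : ℕ) + 1 = n := ⟨⟨n - 1, by omega⟩, by simp; omega⟩
  obtain ⟨p, rfl⟩ : ∃ q : Fin n, (q : ℕ) = p := ⟨⟨p, by omega⟩, rfl⟩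
  have hap : a < p := by rw [Fin.lt_def]; omega
  have hpc : p < c := by rw [Fin.lt_def]; omega
  set L := Finset.Ioo a p with hL
  set R := Finset.Ioo p c with hR
  obtain ⟨s, hs⟩ : ∃ s : ℝ, s = L.card := ⟨_, rfl⟩
  obtain ⟨t, ht⟩ : ∃ t : ℝ, t = R.card := ⟨_, rfl⟩
  have hLc : 0 < L.card := by rw [Fin.card_Ioo]; omega
  have hRc : 0 < R.card := by rw [Fin.card_Ioo]; omega
  have hs0 : 0 < s := by rw [hs]; exact_mod_cast hLc
  have ht0 : 0 < t := by rw [ht]; exact_mod_cast hRc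
  have hn : s + t + 3 = n := by
    have h : (c : ℝ) + 1 = n := by exact_mod_cast hc
    rw [hs, ht, card_Ioo_fin hap, card_Ioo_fin hpc, ha, ← h]
    push_cast
    ring
  have hn0 : (0 : ℝ) < n := by linarith
  -- With these leaf weights and `3 n / 4` on both bridge edges, the quadratic form is at most `3 n`
  -- times the squared norm, and `path_poincare` gives the lower bound 1 on sum-zero vectors.
  obtain ⟨α, hα⟩ : ∃ α : ℝ, α = 3 * n / (2 * s + 1) := ⟨_, rfl⟩
  obtain ⟨β, hβ⟩ : ∃ β : ℝ, β = 3 * n / (2 * t + 1) := ⟨_, rfl⟩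
  have hα1 : 1 ≤ α := by rw [hα, le_div_iff₀ (by positivity)]; linarith
  have hβ1 : 1 ≤ β := by rw [hβ, le_div_iff₀ (by positivity)]; linarith
  have hA := isWeightedAdjacency_bridgedStarsMatrix ha hc hap hpc (α := α) (β := β)
    (w := 3 * n / 4) (by linarith) (by linarith) (by positivity)
  have leaf : ∀ (s z y : ℝ), 0 < s →
      3 * n / (2 * s + 1) * (z - y) ^ 2 ≤ 3 * n * z ^ 2 + 3 * n / (2 * s) * y ^ 2 := by
    intro s z y hs
    have h : 3 * n * z ^ 2 + 3 * n / (2 * s) * y ^ 2 - 3 * n / (2 * s + 1) * (z - y) ^ 2 =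
        3 * n / (2 * s * (2 * s + 1)) * (2 * s * z + y) ^ 2 := by
      field_simp
      ring
    have : 0 ≤ 3 * n / (2 * s * (2 * s + 1)) * (2 * s * z + y) ^ 2 := by positivity
    linarith
  have leaves : ∀ (S : Finset (Fin n)) (x : Fin n → ℝ) (y : ℝ), 0 < S.card →
      3 * n / (2 * (S.card : ℝ) + 1) * ∑ j ∈ S, (x j - y) ^ 2 ≤
        3 * n * ∑ j ∈ S, x j ^ 2 + 3 * n / 2 * y ^ 2 := by
    intro S x y hS
    have hS' : (0 : ℝ) < S.card := by exact_mod_cast hS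
    have h := Finset.sum_le_sum fun j (_ : j ∈ S) => leaf S.card (x j) y hS'
    rw [← Finset.mul_sum, Finset.sum_add_distrib, ← Finset.mul_sum, Finset.sum_const,
      nsmul_eq_mul] at h
    have h2 : (S.card : ℝ) * (3 * n / (2 * (S.card : ℝ)) * y ^ 2) = 3 * n / 2 * y ^ 2 := by
      field_simp
    rwa [h2] at h
  have dp : ∀ x : Fin n → ℝ, x ⬝ᵥ x =
      x a ^ 2 + x p ^ 2 + x c ^ 2 + ∑ j ∈ L, x j ^ 2 + ∑ j ∈ R, x j ^ 2 := by
    intro x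
    rw [dotProduct, sum_eq_split ha hc hap hpc]
    simp only [← sq, hL, hR]
  -- The edge to be reinforced joins the first centre to a leaf. It is disjoint from the bridge and
  -- the second centre, which support the test vector.
  obtain ⟨b, hb⟩ : ∃ b : Fin n, (b : ℕ) = 1 := ⟨⟨1, by omega⟩, rfl⟩
  have hadj : (bridgedStars n p).Adj a b := Or.inl ⟨ha, by omega, by omega⟩
  refine exists_weights_conditionNumber_eq hA (by linarith) (fun x => ?_) (fun x hx => ?_) hadj
    hpc.ne hap.ne (hap.trans hpc).ne (by rw [Ne, Fin.ext_iff]; omega)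
    (by rw [Ne, Fin.ext_iff]; omega)
  · rw [dotProduct_bridgedStars ha hc hap hpc]
    refine le_trans ?_ (mul_le_mul_of_nonneg_right hχ
      (Finset.sum_nonneg fun i _ => mul_self_nonneg (x i)))
    have h1 := leaves L x (x a) hLc
    have h2 := leaves R x (x c) hRc
    rw [← hs, ← hα] at h1
    rw [← ht, ← hβ] at h2
    change _ ≤ 3 * (n : ℝ) * (x ⬝ᵥ x)
    rw [dp]
    have h3 : 3 * (n : ℝ) / 4 * (x a - x p) ^ 2 ≤ 3 * n / 4 * (2 * x a ^ 2 + 2 * x p ^ 2) :=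
      mul_le_mul_of_nonneg_left (by nlinarith [sq_nonneg (x a + x p)]) (by positivity)
    have h4 : 3 * (n : ℝ) / 4 * (x p - x c) ^ 2 ≤ 3 * n / 4 * (2 * x p ^ 2 + 2 * x c ^ 2) :=
      mul_le_mul_of_nonneg_left (by nlinarith [sq_nonneg (x p + x c)]) (by positivity)
    linarith
  · rw [dotProduct_bridgedStars ha hc hap hpc, dp]
    obtain ⟨d₁, hd₁, h1⟩ := sum_sub_sq_ge L x (x a) hLc hα1
    obtain ⟨d₄, hd₄, h4⟩ := sum_sub_sq_ge R x (x c) hRc hβ1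
    rw [← hs] at hd₁ h1
    rw [← ht] at hd₄ h4
    have h0 := mem_sumZero.1 hx
    rw [sum_eq_split ha hc hap hpc, hd₁, hd₄] at h0
    have h := path_poincare hs0 ht0 hn h0
    rw [← hα, ← hβ] at h
    linarith

/-- Moving the bridge by one position changes at most two edges. -/
theorem ncard_symmDiff_bridgedStars {p : ℕ} (hp : p + 1 < n) :
    (symmDiff (bridgedStars n p).edgeSet (bridgedStars n (p + 1)).edgeSet).ncard ≤ 2 := by
  set a : Fin n := ⟨0, by omega⟩
  set b : Fin n := ⟨p, by omega⟩
  set b' : Fin n := ⟨p + 1, by omega⟩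
  set c : Fin n := ⟨n - 1, by omega⟩
  have hsub : symmDiff (bridgedStars n p).edgeSet (bridgedStars n (p + 1)).edgeSet ⊆
      ({s(a, b'), s(b, c)} : Set (Sym2 (Fin n))) := by
    intro e
    induction e with | _ i j
    simp only [Set.mem_symmDiff, SimpleGraph.mem_edgeSet, bridgedStars, Set.mem_insert_iff,
      Set.mem_singleton_iff, Sym2.eq_iff, Fin.ext_iff, a, b, b', c, ne_eq]
    omega
  refine (Set.ncard_le_ncard hsub (Set.toFinite _)).trans ?_
  exact (Set.ncard_insert_le _ _).trans (by rw [Set.ncard_singleton])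

end bridgedStars

/-! ### The motion of the bridge and the spread of information. -/

section schedule

/-- The position of the bridge in a phase of parity `ph`, `r` steps after its start. It moves to the
right in even phases and to the left in odd phases. -/
def phasePosition (v ph r : ℕ) : ℕ :=
  if ph % 2 = 0 then v + min r (6 * v - 1) else 7 * v - 1 - min r (6 * v - 1)

/-- The position of the bridge at time `k`; a phase lasts `6 v + 2` steps. -/
def bridgePosition (v k : ℕ) : ℕ := phasePosition v (k / (6 * v + 2)) (k % (6 * v + 2))

/-- An upper bound for the number of chain coordinates known to node `i`, `r` steps after the start
of phase `ph`. -/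
def phaseLevel (v ph r i : ℕ) : ℕ :=
  if ph % 2 = 0 then
    if i < v + min r (6 * v) ∨ (i + 1 = 8 * v ∧ 6 * v + 1 ≤ r) then ph + 1 else ph
  else
    if 8 * v < i + 1 + v + min r (6 * v) ∨ (i = 0 ∧ 6 * v + 1 ≤ r) then ph + 1 else ph

/-- An upper bound for the number of chain coordinates known to node `i` at time `k`. -/
def level (v k i : ℕ) : ℕ := phaseLevel v (k / (6 * v + 2)) (k % (6 * v + 2)) i

/-- Whether a local computation of node `i` can produce coordinate `m` from the previous ones. -/
def IsActive (v i m : ℕ) : Prop := (i < v ∧ m % 2 = 0) ∨ (7 * v ≤ i ∧ m % 2 = 1)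

theorem div_mod_succ (T k : ℕ) (hT : 0 < T) :
    ((k + 1) / T = k / T ∧ (k + 1) % T = k % T + 1 ∧ k % T + 1 < T) ∨
      ((k + 1) / T = k / T + 1 ∧ (k + 1) % T = 0 ∧ k % T + 1 = T) := by
  have h1 := Nat.mod_lt k hT
  have h2 := Nat.div_add_mod k T
  by_cases h : k % T + 1 < T
  · left
    have h3 := (Nat.div_mod_unique (a := k + 1) (d := k / T) (c := k % T + 1) hT).2
      ⟨by linarith, h⟩
    exact ⟨h3.1, h3.2, h⟩
  · right
    have h4 : k % T + 1 = T := by omega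
    have h3 := (Nat.div_mod_unique (a := k + 1) (d := k / T + 1) (c := 0) hT).2
      ⟨by rw [mul_add]; linarith, hT⟩
    exact ⟨h3.1, h3.2, h4⟩

/-- Both stars always keep a leaf other than the bridge. -/
theorem bridgePosition_bounds {v : ℕ} (hv : 2 ≤ v) (k : ℕ) :
    2 ≤ bridgePosition v k ∧ bridgePosition v k + 3 ≤ 8 * v := by
  unfold bridgePosition phasePosition
  split_ifs <;> omega

theorem bridgePosition_succ {v : ℕ} (hv : 2 ≤ v) (k : ℕ) :
    bridgePosition v (k + 1) = bridgePosition v k ∨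
      bridgePosition v (k + 1) = bridgePosition v k + 1 ∨
      bridgePosition v k = bridgePosition v (k + 1) + 1 := by
  unfold bridgePosition
  rcases div_mod_succ (6 * v + 2) k (by omega) with ⟨h1, h2, h3⟩ | ⟨h1, h2, h3⟩
  · rw [h1, h2]
    unfold phasePosition
    split_ifs <;> omega
  · rw [h1, h2]
    unfold phasePosition
    split_ifs <;> omega

theorem level_le (v k i : ℕ) : level v k i ≤ k / (6 * v + 2) + 1 := by
  unfold level phaseLevel
  split_ifs <;> omega

/-- Within a phase, the only node of the receiving group at the higher level is its centre, at the
last step. Using that level to compute the next coordinate therefore falls in the new phase, which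
already grants it to the whole group. -/
theorem level_local {v : ℕ} (hv : 2 ≤ v) (k i : ℕ) :
    level v k i ≤ level v (k + 1) i ∧
      (IsActive v i (level v k i) → level v k i + 1 ≤ level v (k + 1) i) := by
  unfold level
  rcases div_mod_succ (6 * v + 2) k (by omega) with ⟨h1, h2, h3⟩ | ⟨h1, h2, h3⟩
  · rw [h1, h2]
    generalize k / (6 * v + 2) = ph at *
    generalize k % (6 * v + 2) = r at *
    unfold phaseLevel IsActive
    constructor
    · split_ifs <;> omega
    · split_ifs <;> omega
  · rw [h1, h2]
    generalize k / (6 * v + 2) = ph at *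
    generalize k % (6 * v + 2) = r at *
    unfold phaseLevel IsActive
    constructor
    · split_ifs <;> omega
    · split_ifs <;> omega

/-- During the crossing the star that has the newest coordinate consists of nodes at the higher
level plus the bridge, which is just beyond the frontier. One round advances the frontier by one
node, and the bridge moves with it. At the end the bridge stops at the receiving group, and one more
round reaches the other centre. -/
theorem level_communication {v : ℕ} (hv : 2 ≤ v) (k : ℕ) {i j : Fin (8 * v)}
    (hij : (bridgedStars (8 * v) (bridgePosition v k)).Adj i j ∨ j = i) :
    level v k j ≤ level v (k + 1) i := by
  rcases hij with hij | rfl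
  swap
  · exact (level_local hv k j).1
  have hi := i.2
  have hj := j.2
  unfold bridgePosition at hij
  unfold level
  simp only [bridgedStars, Fin.ext_iff, ne_eq] at hij
  generalize (i : ℕ) = i at *
  generalize (j : ℕ) = j at *
  rcases div_mod_succ (6 * v + 2) k (by omega) with ⟨h1, h2, h3⟩ | ⟨h1, h2, h3⟩
  · rw [h1, h2]
    generalize k / (6 * v + 2) = ph at *
    generalize k % (6 * v + 2) = r at *
    unfold phasePosition at hij
    unfold phaseLevel
    split_ifs at hij ⊢ <;> omega
  -- At a phase change every node is granted at least `ph + 1`, the maximal level of the old phase.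
  · rw [h1, h2]
    generalize k / (6 * v + 2) = ph at *
    generalize k % (6 * v + 2) = r at *
    unfold phaseLevel
    split_ifs <;> omega

end schedule

/-! ### The local objectives. -/

section problem

variable (e : ℕ → Ell2) (x₀ : Ell2)

/-- The projection in the objective of node `i`: odd links for the first `v` nodes, even links for
the last `v` nodes. -/
noncomputable def nodeProjection (v i : ℕ) : Ell2 →L[ℝ] Ell2 :=
  if i < v then linkProjection e 1 else if 7 * v ≤ i then linkProjection e 0 else 0

/-- The linear term in the objective of node `i`. -/
noncomputable def nodeOffset (v : ℕ) (β : ℝ) (i : ℕ) : Ell2 := if i < v then β • e 0 else 0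

/-- The objective of node `i`. -/
noncomputable def nodeObjective (v : ℕ) (μ g β : ℝ) (i : ℕ) : Ell2 → ℝ :=
  quadraticObjective (shiftedProjection (nodeProjection e v i) μ g) (nodeOffset e v β i) x₀

variable {e x₀}

theorem nodeProjection_symm (v i : ℕ) (x y : Ell2) :
    inner ℝ (nodeProjection e v i x) y = inner ℝ x (nodeProjection e v i y) := by
  unfold nodeProjection
  split_ifs
  · exact linkProjection_symm _ _ _ _
  · exact linkProjection_symm _ _ _ _
  · simp

theorem nodeProjection_idem (v i : ℕ) (x : Ell2) :
    nodeProjection e v i (nodeProjection e v i x) = nodeProjection e v i x := by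
  unfold nodeProjection
  split_ifs
  · exact linkProjection_idem _ _ _
  · exact linkProjection_idem _ _ _
  · simp

theorem nodeProjection_mem_krylov (he : Orthonormal ℝ e) (h₀ : ∀ i, inner ℝ (e i) x₀ = 0)
    {v i m m' : ℕ} (hm : m ≤ m') (h : IsActive v i m → m + 1 ≤ m') {x : Ell2}
    (hx : x ∈ krylov e x₀ m) : nodeProjection e v i x ∈ krylov e x₀ m' := by
  unfold IsActive at h
  unfold nodeProjection
  split_ifs
  · exact linkProjection_mem_krylov he h₀ le_rfl hm (by omega) hx
  · exact linkProjection_mem_krylov he h₀ zero_le_one hm (by omega) hx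
  · simp

theorem nodeOffset_mem_krylov {v i m m' : ℕ} (hm : m ≤ m') (h : IsActive v i m → m + 1 ≤ m')
    (β : ℝ) : nodeOffset e v β i ∈ krylov e x₀ m' := by
  unfold IsActive at h
  unfold nodeOffset
  split_ifs
  · exact Submodule.smul_mem _ _ (mem_krylov (by omega))
  · exact Submodule.zero_mem _

theorem isLSmooth_nodeObjective {μ g L : ℝ} (hμ : 0 ≤ μ) (hg : 0 ≤ g) (hL : μ + g ≤ L)
    (v : ℕ) (β : ℝ) (i : ℕ) : IsLSmooth L (nodeObjective e x₀ v μ g β i) :=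
  isLSmooth_quadraticObjective (shiftedProjection_symm (nodeProjection_symm v i))
    (fun x => (norm_shiftedProjection_le (nodeProjection_symm v i) (nodeProjection_idem v i)
      hμ hg x).trans (mul_le_mul_of_nonneg_right hL (norm_nonneg x))) _ _

theorem isMuStronglyConvex_nodeObjective {μ g : ℝ} (hg : 0 ≤ g) (v : ℕ) (β : ℝ) (i : ℕ) :
    IsMuStronglyConvex μ (nodeObjective e x₀ v μ g β i) :=
  isMuStronglyConvex_quadraticObjective (shiftedProjection_symm (nodeProjection_symm v i))
    (le_inner_shiftedProjection (nodeProjection_symm v i) (nodeProjection_idem v i) hg) _ _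

theorem gradient_nodeObjective (v : ℕ) (μ g β : ℝ) (i : ℕ) (x : Ell2) :
    gradient (nodeObjective e x₀ v μ g β i) x =
      μ • (x - x₀) + g • nodeProjection e v i (x - x₀) - nodeOffset e v β i := by
  rw [nodeObjective, gradient_quadraticObjective (shiftedProjection_symm (nodeProjection_symm v i)),
    shiftedProjection_apply]

theorem gradient_fenchelConjugate_nodeObjective {μ g : ℝ} (hμ : 0 < μ) (hg : 0 ≤ g) (v : ℕ)
    (β : ℝ) (i : ℕ) (y : Ell2) :
    gradient (fenchelConjugate (nodeObjective e x₀ v μ g β i)) y =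
      μ⁻¹ • (y + nodeOffset e v β i) +
        ((μ + g)⁻¹ - μ⁻¹) • nodeProjection e v i (y + nodeOffset e v β i) + x₀ := by
  rw [nodeObjective, gradient_fenchelConjugate_quadraticObjective
    (R := shiftedProjection (nodeProjection e v i) μ⁻¹ ((μ + g)⁻¹ - μ⁻¹))
    (shiftedProjection_symm (nodeProjection_symm v i))
    (fun x => le_trans (by positivity)
      (le_inner_shiftedProjection (nodeProjection_symm v i) (nodeProjection_idem v i) hg x))
    (shiftedProjection_inverse (nodeProjection_idem v i) hμ hg), shiftedProjection_apply]

/-- A local computation raises the number of known coordinates by at most one, and only at active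
nodes. -/
theorem local_mem_krylov (he : Orthonormal ℝ e) (h₀ : ∀ i, inner ℝ (e i) x₀ = 0)
    {μ g : ℝ} (hμ : 0 < μ) (hg : 0 ≤ g) {v i m m' : ℕ} (hm : m ≤ m')
    (h : IsActive v i m → m + 1 ≤ m') (β : ℝ) {x : Ell2} (hx : x ∈ krylov e x₀ m) :
    x ∈ krylov e x₀ m' ∧ gradient (nodeObjective e x₀ v μ g β i) x ∈ krylov e x₀ m' ∧
      gradient (fenchelConjugate (nodeObjective e x₀ v μ g β i)) x ∈ krylov e x₀ m' := by
  have hx' : x ∈ krylov e x₀ m' := krylov_mono e x₀ hm hx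
  have hb : nodeOffset e v β i ∈ krylov e x₀ m' := nodeOffset_mem_krylov hm h β
  have hs := mem_krylov_start e x₀ m
  have hs' := mem_krylov_start e x₀ m'
  -- The conjugate gradient applies the projection to the offset as well; `e 0` lies in no odd link,
  -- so this produces no further coordinate.
  have hPb : nodeProjection e v i (nodeOffset e v β i) = 0 := by
    unfold nodeProjection nodeOffset
    split_ifs
    · rw [map_smul, linkProjection_one_zero he, smul_zero]
    · rw [map_zero]
    · rw [map_zero]
  refine ⟨hx', ?_, ?_⟩
  · rw [gradient_nodeObjective]
    exact Submodule.sub_mem _ (Submodule.add_mem _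
      (Submodule.smul_mem _ _ (Submodule.sub_mem _ hx' hs'))
      (Submodule.smul_mem _ _ (nodeProjection_mem_krylov he h₀ hm h (Submodule.sub_mem _ hx hs))))
      hb
  · rw [gradient_fenchelConjugate_nodeObjective hμ hg, map_add, hPb, add_zero]
    exact Submodule.add_mem _ (Submodule.add_mem _
      (Submodule.smul_mem _ _ (Submodule.add_mem _ hx' hb))
      (Submodule.smul_mem _ _ (nodeProjection_mem_krylov he h₀ hm h hx))) hs'

theorem sum_nodes {M : Type*} [AddCommMonoid M] (v : ℕ) (F : ℕ → M) (x y z : M)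
    (hx : ∀ i < v, F i = x) (hy : ∀ i, v ≤ i → i < 7 * v → F i = y) (hz : ∀ i, 7 * v ≤ i → F i = z) :
    ∑ i : Fin (8 * v), F i = v • x + (6 * v) • y + v • z := by
  rw [Fin.sum_univ_eq_sum_range F, show 8 * v = v + 6 * v + v by ring, Finset.sum_range_add,
    Finset.sum_range_add]
  congr 1
  · congr 1
    · rw [Finset.sum_congr rfl fun i hi => hx i (Finset.mem_range.1 hi)]
      simp
    · rw [Finset.sum_congr rfl fun i hi => hy _ (by omega) (by
        have := Finset.mem_range.1 hi; omega)]
      simp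
  · rw [Finset.sum_congr rfl fun i hi => hz _ (by omega)]
    simp

/-- The gradients of all objectives cancel at `x₀ + ∑ qⁱ eᵢ`. -/
theorem sum_gradient_nodeObjective (he : Orthonormal ℝ e) {q μ c : ℝ} (h0 : 0 < q) (h1 : q < 1)
    (hc : c * (1 - q) ^ 2 = μ * q) (v : ℕ) :
    ∑ i : Fin (8 * v), gradient (nodeObjective e x₀ v μ (16 * c) (8 * (μ + c * (1 - q))) i)
      (x₀ + geometricVector e q) = 0 := by
  set y := geometricVector e q with hy
  have hst := chain_stationary he h0 h1 hc
  rw [← hy] at hst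
  simp only [gradient_nodeObjective, add_sub_cancel_left]
  rw [sum_nodes v (fun i => μ • y + (16 * c) • nodeProjection e v i y
      - nodeOffset e v (8 * (μ + c * (1 - q))) i)
    (μ • y + (16 * c) • linkProjection e 1 y - (8 * (μ + c * (1 - q))) • e 0) (μ • y)
    (μ • y + (16 * c) • linkProjection e 0 y)]
  -- Each special group is one eighth of the nodes, so averaging turns `16 c` into the `2 c` of the
  -- chain equation and cancels the factor 8 of the offset.
  · have key : (v : ℝ) • (μ • y + (16 * c) • linkProjection e 1 y
        - (8 * (μ + c * (1 - q))) • e 0) + (6 * v : ℝ) • (μ • y) +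
        (v : ℝ) • (μ • y + (16 * c) • linkProjection e 0 y) =
        (8 * v : ℝ) • ((μ • y + (2 * c) • (linkProjection e 1 y + linkProjection e 0 y)) -
          (μ + c * (1 - q)) • e 0) := by
      module
    rw [hst, sub_self, smul_zero] at key
    rw [← key]
    simp only [← Nat.cast_smul_eq_nsmul ℝ]
    push_cast
    rfl
  · intro i hi
    simp [nodeProjection, nodeOffset, hi]
  · intro i hi hi'
    simp [nodeProjection, nodeOffset, Nat.not_lt.2 hi, Nat.not_le.2 hi']
  · intro i hi
    by_cases hv : i < v
    · omega
    · simp [nodeProjection, nodeOffset, hv, hi]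

end problem

/-! ### Assembling the lower bound. -/

/-- A zero of the sum of the gradients of strongly convex functions minimizes their average. -/
theorem globalFunction_le_of_sum_gradient_eq_zero (P : DecentralizedProblem) {μ : ℝ} (hμ : 0 ≤ μ)
    (hP : ∀ i, IsMuStronglyConvex μ (P.f i)) {xs : Ell2}
    (h : ∑ i, gradient (P.f i) xs = 0) (x : Ell2) :
    P.globalFunction xs ≤ P.globalFunction x := by
  unfold DecentralizedProblem.globalFunction
  refine mul_le_mul_of_nonneg_left ?_ (by positivity)
  have h1 : ∑ i, (P.f i xs + inner ℝ (gradient (P.f i) xs) (x - xs)) ≤ ∑ i, P.f i x := by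
    refine Finset.sum_le_sum fun i _ => ?_
    have h2 := (hP i).2 xs x
    have h3 : 0 ≤ μ / 2 * ‖x - xs‖ ^ 2 := by positivity
    linarith
  rw [Finset.sum_add_distrib, ← sum_inner, h, inner_zero_left, add_zero] at h1
  exact h1

/-- The bound on the number of coordinates known to each node, for every method. -/
theorem memory_subset_krylov (M : FirstOrderMethod) {e : ℕ → Ell2} (he : Orthonormal ℝ e)
    (h₀ : ∀ i, inner ℝ (e i) M.x₀ = 0) {μ g β : ℝ} (hμ : 0 < μ) (hg : 0 ≤ g) {v : ℕ}
    (hv : 2 ≤ v) (W : ℕ → Matrix (Fin (8 * v)) (Fin (8 * v)) ℝ) (k : ℕ) (i : Fin (8 * v)) :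
    M.memory ⟨8 * v, fun i => nodeObjective e M.x₀ v μ g β i,
      fun k => bridgedStars (8 * v) (bridgePosition v k), W⟩ k i ⊆
        krylov e M.x₀ (level v k i) := by
  set P : DecentralizedProblem := ⟨8 * v, fun i => nodeObjective e M.x₀ v μ g β i,
      fun k => bridgedStars (8 * v) (bridgePosition v k), W⟩ with hP
  induction k generalizing i with
  | zero =>
    have h := M.memory_zero P i
    rw [h, singleton_subset_iff]
    exact mem_krylov_start _ _ _
  | succ k ih =>
    by_cases hk : M.isComm P k
    · refine (M.memory_comm P k hk i).trans (SetLike.coe_subset_coe.2 (Submodule.span_le.2 ?_))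
      refine iUnion₂_subset fun j hj => (ih j).trans ?_
      exact SetLike.coe_subset_coe.2 (krylov_mono e M.x₀ (level_communication hv k hj))
    · refine (M.memory_local P k hk i).trans (SetLike.coe_subset_coe.2 (Submodule.span_le.2 ?_))
      refine iUnion₂_subset fun x hx => ?_
      obtain ⟨h1, h2⟩ := level_local hv k i
      obtain ⟨m1, m2, m3⟩ := local_mem_krylov he h₀ hμ hg h1 h2 β (ih i hx)
      rintro y (rfl | rfl | rfl)
      · exact m1
      · exact m2
      · exact m3

/-- Since `q < 1`, it suffices to compare exponents, and `7 χ ≤ 36 T` says exactly that `2 / T ≤ 72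
/ (7 χ)`. -/
theorem rpow_bound {q χ : ℝ} (hq0 : 0 < q) (hq1 : q < 1) (hχ : 0 < χ) {T k m : ℕ} (hT0 : 0 < T)
    (hT : 7 * χ ≤ 36 * T) (hm : m ≤ k / T + 1) :
    q ^ (72 * (k : ℝ) / (7 * χ) + 2) ≤ q ^ (2 * m) := by
  rw [← Real.rpow_natCast]
  refine Real.rpow_le_rpow_of_exponent_ge hq0 hq1.le ?_
  have h1 : (m : ℝ) ≤ (k : ℝ) / T + 1 := by
    have h2 : (m : ℝ) ≤ ((k / T : ℕ) : ℝ) + 1 := by exact_mod_cast hm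
    have h3 : ((k / T : ℕ) : ℝ) ≤ (k : ℝ) / T := Nat.cast_div_le
    linarith
  have hT0' : (0 : ℝ) < T := by exact_mod_cast hT0
  have h4 : 2 * ((k : ℝ) / T) ≤ 72 * (k : ℝ) / (7 * χ) := by
    rw [← mul_div_assoc, div_le_div_iff₀ hT0' (by positivity)]
    nlinarith [(Nat.cast_nonneg k : (0 : ℝ) ≤ k)]
  push_cast
  linarith

theorem mainTheorem4 (χ L μ : ℝ) (hχ : 56 ≤ χ) (hμ : 0 < μ) (hL : 16 * μ < L)
    (M : FirstOrderMethod) :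
    ∃ P : DecentralizedProblem,
      (∀ i, IsLSmooth L (P.f i)) ∧
      (∀ i, IsMuStronglyConvex μ (P.f i)) ∧
      (∀ k, (symmDiff (P.G k).edgeSet (P.G (k + 1)).edgeSet).ncard ≤ 2) ∧
      (∀ k, IsWeightedLaplacianOf (P.G k) (P.W k) ∧ IsGossipMatrix (P.G k) (P.W k) ∧
        HasConditionNumber (P.W k) χ) ∧
      ∃ xs : Ell2, (∀ x, P.globalFunction xs ≤ P.globalFunction x) ∧ xs ≠ M.x₀ ∧
        ∀ (k : ℕ) (i : Fin P.n), ∀ x ∈ M.memory P k i,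
          (1 - 4 * Real.sqrt (μ / L)) ^ (72 * (k : ℝ) / (7 * χ) + 2) * ‖M.x₀ - xs‖ ^ 2
            ≤ ‖x - xs‖ ^ 2 := by
  have hL0 : 0 < L := by linarith
  obtain ⟨u, hu⟩ : ∃ u, u = Real.sqrt (μ / L) := ⟨_, rfl⟩
  have hu0 : 0 < u := by rw [hu]; exact Real.sqrt_pos.2 (by positivity)
  have hu2 : u ^ 2 * L = μ := by
    rw [hu, Real.sq_sqrt (by positivity)]
    field_simp
  have hu1 : u < 1 / 4 := by
    by_contra! h
    have h1 : 1 / 16 ≤ u ^ 2 := by nlinarith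
    linarith [mul_le_mul_of_nonneg_right h1 hL0.le]
  rw [← hu]
  obtain ⟨q, hq⟩ : ∃ q, q = 1 - 4 * u := ⟨_, rfl⟩
  have hq0 : 0 < q := by linarith
  have hq1 : q < 1 := by linarith
  -- With `1 - q = 4 u` and `μ = u² L`, this value solves `c (1 - q)² = μ q`. It also gives `μ + 16
  -- c = L (1 - 4 u + u²) ≤ L`.
  obtain ⟨c, hc⟩ : ∃ c, c = q * L / 16 := ⟨_, rfl⟩
  have hc0 : 0 ≤ 16 * c := by rw [hc]; positivity
  have hcq : c * (1 - q) ^ 2 = μ * q := by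
    have : 1 - q = 4 * u := by linarith
    rw [this, hc, ← hu2]
    ring
  have hcL : μ + 16 * c ≤ L := by
    rw [hc, hq, ← hu2]
    nlinarith [mul_pos hu0 hL0]
  -- The largest `v` with `3 n = 24 v ≤ χ`, as the weights require.
  obtain ⟨v, hv⟩ : ∃ v : ℕ, v = ⌊χ / 24⌋₊ := ⟨_, rfl⟩
  have hv2 : 2 ≤ v := by
    rw [hv]
    exact Nat.le_floor (by push_cast; linarith)
  have hvχ : 24 * (v : ℝ) ≤ χ := by
    have := Nat.floor_le (show 0 ≤ χ / 24 by positivity)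
    rw [← hv] at this
    linarith
  have hχv : χ < 24 * ((v : ℝ) + 1) := by
    have := Nat.lt_floor_add_one (χ / 24)
    rw [← hv] at this
    linarith
  obtain ⟨e, he, h₀⟩ := exists_orthonormal_sequence_orthogonal M.x₀
  have hW : ∀ k, ∃ W, IsWeightedLaplacianOf (bridgedStars (8 * v) (bridgePosition v k)) W ∧
      IsGossipMatrix (bridgedStars (8 * v) (bridgePosition v k)) W ∧ HasConditionNumber W χ :=
    fun k => exists_weights_bridgedStars (bridgePosition_bounds hv2 k).1
      (bridgePosition_bounds hv2 k).2 (by push_cast; linarith)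
  choose W hW using hW
  refine ⟨⟨8 * v, fun i => nodeObjective e M.x₀ v μ (16 * c) (8 * (μ + c * (1 - q))) i,
      fun k => bridgedStars (8 * v) (bridgePosition v k), W⟩,
    fun i => isLSmooth_nodeObjective hμ.le hc0 hcL v _ _,
    fun i => isMuStronglyConvex_nodeObjective hc0 v _ _, fun k => ?_, hW,
    M.x₀ + geometricVector e q, ?_, ?_, fun k i x hx => ?_⟩
  · have h1 := bridgePosition_bounds hv2 k
    have h2 := bridgePosition_bounds hv2 (k + 1)
    change (symmDiff (bridgedStars (8 * v) (bridgePosition v k)).edgeSet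
      (bridgedStars (8 * v) (bridgePosition v (k + 1))).edgeSet).ncard ≤ 2
    rcases bridgePosition_succ hv2 k with h | h | h
    · rw [h, symmDiff_self]
      simp
    · rw [h]
      exact ncard_symmDiff_bridgedStars (by omega)
    · rw [h, symmDiff_comm]
      exact ncard_symmDiff_bridgedStars (by omega)
  · exact globalFunction_le_of_sum_gradient_eq_zero _ hμ.le
      (fun i => isMuStronglyConvex_nodeObjective hc0 v _ _)
      (sum_gradient_nodeObjective he hq0 hq1 hcq v)
  · intro h
    have h1 : geometricVector e q = 0 := by simpa using h
    have h2 := norm_sq_geometricVector he hq0.le hq1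
    have h3 : 0 < (1 - q ^ 2)⁻¹ := inv_pos.2 (by nlinarith)
    rw [h1, norm_zero, zero_pow two_ne_zero] at h2
    exact h3.ne h2
  · have hmem := memory_subset_krylov M he h₀ hμ hc0 hv2 W k i hx
    have h1 := norm_sub_geometricVector_ge he h₀ hq0.le hq1 hmem
    rw [← hq]
    refine le_trans (mul_le_mul_of_nonneg_right ?_ (sq_nonneg _)) h1
    have hv2' : (2 : ℝ) ≤ v := by exact_mod_cast hv2
    -- The condition `7 χ ≤ 36 (6 v + 2)` follows from `χ < 24 (v + 1)`, as `168 v + 168 ≤ 216 v +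
    -- 72` for `v ≥ 2`.
    exact rpow_bound hq0 hq1 (by linarith) (T := 6 * v + 2) (by omega)
      (by push_cast; linarith) (level_le v k i)
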